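/- **Setting.** A *rule* $r$ is $a_1\vee\dots\vee a_\ell\leftarrow a_{\ell+1},\dots,a_m,\neg a_{m+1},\dots,\neg a_n$ with pairwise distinct atoms, $0\le\ell\le m\le n$; put $H_r=\{a_1,\dots,a_\ell\}$, $B_r^+=\{a_{\ell+1},\dots,a_m\}$, $B_r^-=\{a_{m+1},\dots,a_n\}$, $\mathrm{at}(r)=H_r\cup B_r^+\cup B_r^-$. A *program* $\Pi$ is a finite set of rules, $\mathrm{at}(\Pi)=\bigcup_{r\in\Pi}\mathrm{at}(r)$. A set $I$ of atoms satisfies $r$ if $(H_r\cup B_r^-)\cap I\ne\emptyset$ or $B_r^+\setminus I\neq\emptyset$; $I\models\Pi$ ($I$ is a model of $\Pi$) if it satisfies all rules of $\Pi$. The reduct $\Pi^I$ is obtained by deleting the rules with $B_r^-\cap I\ne\emptyset$ and deleting the negative bodies of the remaining rules; $I$ is an *answer set* of $\Pi$ if it is a subset-minimal model of $\Pi^I$. $\Pi$ is *head-cycle-free* if there are no rule $r\in\Pi$ and distinct $a,b\in H_r$ lying on a common closed directed walk of the digraph with edges $(a',b')$ for $a'\in B_r^+$, $b'\in H_r$,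 $r\in\Pi$. An *instance* of #PAS is a pair $(\Pi,P)$ with $P\subseteq\mathrm{at}(\Pi)$; its *projected answer sets count* is $|\{I\cap P : I\text{ is an answer set of }\Pi\}|$. The *primal graph* $G_\Pi$ has vertex set $\mathrm{at}(\Pi)$ and an edge between any two distinct atoms of a common rule. A *tree decomposition* of a graph $(V,E)$ is a finite rooted tree with bags $\chi(t)\subseteq V$ that cover all vertices and edges and satisfy $\chi(r)\cap\chi(t)\subseteq\chi(s)$ whenever the node $s$ lies on the path from $r$ to $t$. It is *nice* if the root and leaf bags are empty and every node $t$ is a *leaf*, or has one child $t_1$ and $\chi(t)=\chi(t_1)\cup\{a\}$, $a\notin\chi(t_1)$ (*introduce*) or $\chi(t)=\chi(t_1)\setminus\{a\}$, $a\in\chi(t_1)$ (*removal*), or has two children $t_1,t_2$ and $\chi(t)=\chi(t_1)=\chi(t_2)\neq\emptyset$ (*join*). Children are ordered; let $\Pi_t=\{r\in\Pi:\mathrm{at}(r)\subseteq\chi(t)\}$. **Algorithm $\mathrm{MDP}_{\mathrm{PHC}}$** on $(\Pi,P)$ takes a nice tree decomposition of $G_\Pi$ with root $n$ and proceeds as follows.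 1. *$\mathrm{DP}_{\mathrm{PHC}}$.* Bottom-up, compute at each node $t$ (children $t_1,\dots$) a table $\tau(t)=\mathrm{PHC}(t,\langle\tau(t_1),\dots\rangle)$ of rows $\langle I,\mathcal P,\sigma\rangle$ ($I,\mathcal P$ sets of atoms, $\sigma$ a sequence of atoms): - leaf: $\{\langle\emptyset,\emptyset,\langle\rangle\rangle\}$; - introduce $a$: all $\langle J,\mathcal P\cup\mathrm{gp}(J,\sigma'),\sigma'\rangle$ with $\langle I,\mathcal P,\sigma\rangle\in\tau(t_1)$, $J\in\{I,I\cup\{a\}\}$, $J\models\Pi_t$, where $\sigma'=\sigma$ if $a\notin J$, and $\sigma'$ arises from $\sigma$ by inserting $a$ at an arbitrary position if $a\in J$; here $\mathrm{gp}(J,\sigma')$ is the set of all $c$ such that for some $r\in\Pi_t$: $c\in H_r$, $B_r^+\subseteq J$, $J\cap B_r^-=\emptyset$, $J\cap(H_r\setminus\{c\})=\emptyset$, and every $b\in B_r^+$ precedes $c$ in $\sigma'$; - remove $a$: all $\langle I\setminus\{a\},\mathcal P\setminus\{a\},\sigma-a\rangle$ with $\langle I,\mathcal P,\sigma\rangle\in\tau(t_1)$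 and ($a\in\mathcal P$ or $a\notin I$), where $\sigma-a$ deletes $a$ from $\sigma$; - join: all $\langle I,\mathcal P_1\cup\mathcal P_2,\sigma\rangle$ with $\langle I,\mathcal P_1,\sigma\rangle\in\tau(t_1)$, $\langle I,\mathcal P_2,\sigma\rangle\in\tau(t_2)$. 2. *Purging.* For a row $u$ at $t$ with children $t_1,\dots,t_\ell$, its *origins* are the sequences $\langle s_1,\dots,s_\ell\rangle\in\tau(t_1)\times\dots\times\tau(t_\ell)$ with $u\in\mathrm{PHC}(t,\langle\{s_1\},\dots,\{s_\ell\}\rangle)$; $\mathrm{orig}(t,\rho)$ is the set of origins of rows of $\rho$. Put $\nu(n)=\tau(n)$ and, top-down, let $\nu(t_i)$ be the set of all $i$-th entries of members of $\mathrm{orig}(t,\nu(t))$. 3. *$\mathrm{DP}_{\mathrm{PROJ}}$.* Bottom-up, compute $\pi(t)=\{\langle\rho,\mathrm{ipmc}(t,\rho)\rangle\}$, where $\rho$ ranges over the non-empty subsets of the equivalence classes of $\nu(t)$ under the relation $I\cap P=I'\cap P$ between rows $\langle I,\cdot,\cdot\rangle$, $\langle I',\cdot,\cdot\rangle$. Here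 $\mathrm{ipmc}(t,\rho)=1$ at leaves and otherwise $$\mathrm{ipmc}(t,\rho)=\Big|\mathrm{pmc}(t,\rho)+\sum_{\emptyset\subsetneq\varphi\subsetneq\rho}(-1)^{|\varphi|}\,\mathrm{ipmc}(t,\varphi)\Big|,\qquad \mathrm{pmc}(t,\rho)=\sum_{\emptyset\subsetneq O\subseteq\mathrm{orig}(t,\rho)}(-1)^{|O|-1}\prod_{i=1}^{\ell}\mathrm{s}\big(\pi(t_i),O_{(i)}\big),$$ with $O_{(i)}$ the set of $i$-th entries of members of $O$, and $\mathrm s(\pi(t'),\rho')=\sum_{\langle\rho',c\rangle\in\pi(t')}c$ (so $0$ if $\rho'$ is not stored). 4. *Output* $\mathrm s\big(\pi(n),\{\langle\emptyset,\emptyset,\langle\rangle\rangle\}\big)$. **Proposition.** Let $(\Pi,P)$ be an instance of #PAS such that $\Pi$ is head-cycle-free and is not the program whose only rule is the empty rule ($H_r=B_r^+=B_r^-=\emptyset$). Then $G_\Pi$ has a nice tree decomposition, and for every nice tree decomposition of $G_\Pi$ the algorithm $\mathrm{MDP}_{\mathrm{PHC}}$ outputs the projected answer sets count of $(\Pi,P)$.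 -/

import Mathlib

namespace PASP

/-! ### Answer set programs -/

/-- A disjunctive rule `a₁ ∨ ⋯ ∨ aₗ ← aₗ₊₁, …, aₘ, ¬ aₘ₊₁, …, ¬ aₙ` over pairwise distinct atoms. -/
structure Rule (α : Type*) where
  head : Finset α
  posBody : Finset α
  negBody : Finset α
  head_pos : Disjoint head posBody
  head_neg : Disjoint head negBody
  pos_neg : Disjoint posBody negBody
  deriving DecidableEq

/-- The rule without any atom. -/
def Rule.empty (α : Type*) : Rule α :=
  ⟨∅, ∅, ∅, Finset.disjoint_empty_left _, Finset.disjoint_empty_left _,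
    Finset.disjoint_empty_left _⟩

/-- A program is a finite set of rules. -/
abbrev Program (α : Type*) := Finset (Rule α)

variable {α : Type*} [DecidableEq α]

def Rule.atoms (r : Rule α) : Finset α := r.head ∪ r.posBody ∪ r.negBody

def atoms (prog : Program α) : Finset α := prog.biUnion Rule.atoms

/-- The interpretation `I` satisfies the rule `r`. -/
def Rule.Sat (I : Finset α) (r : Rule α) : Prop :=
  ((r.head ∪ r.negBody) ∩ I).Nonempty ∨ (r.posBody \ I).Nonempty

instance (I : Finset α) (r : Rule α) : Decidable (r.Sat I) := by
  unfold Rule.Sat; infer_instance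

/-- `I` is a model of the program. -/
def IsModel (prog : Program α) (I : Finset α) : Prop := ∀ r ∈ prog, r.Sat I

instance (prog : Program α) (I : Finset α) : Decidable (IsModel prog I) := by
  unfold IsModel; infer_instance

/-- The rule with its negative body removed. -/
def Rule.positivePart (r : Rule α) : Rule α :=
  ⟨r.head, r.posBody, ∅, r.head_pos, Finset.disjoint_empty_right _,
    Finset.disjoint_empty_right _⟩

/-- The Gelfond-Lifschitz reduct of the program under `I`. -/
def reduct (prog : Program α) (I : Finset α) : Program α :=
  (prog.filter fun r => Disjoint r.negBody I).image Rule.positivePart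

/-- `I` is an answer set: a (subset-)minimal model of the reduct under `I`. -/
def IsAnswerSet (prog : Program α) (I : Finset α) : Prop :=
  Minimal (IsModel (reduct prog I)) I

/-- The edge relation of the positive dependency digraph. -/
def DepEdge (prog : Program α) (a b : α) : Prop :=
  ∃ r ∈ prog, a ∈ r.posBody ∧ b ∈ r.head

/-- No two distinct atoms of one head lie on a common cycle (closed directed walk) of the positive
dependency digraph. -/
def HeadCycleFree (prog : Program α) : Prop :=
  ¬ ∃ r ∈ prog, ∃ a ∈ r.head, ∃ b ∈ r.head, a ≠ b ∧
    Relation.TransGen (DepEdge prog) a b ∧ Relation.TransGen (DepEdge prog) b a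

/-- The projected answer sets count of the program with respect to `P`: the number of sets
`I ∩ P` where `I` is an answer set. -/
noncomputable def projectedCount (prog : Program α) (P : Finset α) : ℕ :=
  Set.ncard ((fun I => I ∩ P) '' {I | IsAnswerSet prog I})

/-! ### Tabled tree decompositions -/

/-- A finite rooted ordered tree whose nodes have at most two children, where each node `t` carries
a bag `χ(t)` and a table from `β`. (Nodes of nice tree decompositions have at most two children.) -/
inductive TTree (α β : Type*) where
  | leaf (bag : Finset α) (tab : β)
  | unary (bag : Finset α) (tab : β) (child : TTree α β)
  | binary (bag : Finset α) (tab : β) (left right : TTree α β)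

namespace TTree

variable {α β ι ο : Type*}

/-- The bag of the root. -/
def bag : TTree α β → Finset α
  | leaf b _ => b
  | unary b _ _ => b
  | binary b _ _ _ => b

/-- The table of the root. -/
def tab : TTree α β → β
  | leaf _ x => x
  | unary _ x _ => x
  | binary _ x _ _ => x

/-- The sequence of subtrees rooted at the children of the root. -/
def children : TTree α β → List (TTree α β)
  | leaf _ _ => []
  | unary _ _ c => [c]
  | binary _ _ l r => [l, r]

/-- Nodes are addressed by the sequence of child indices on the way down from the root; this is the
subtree rooted at the node with the given address, if there is such a node. -/
def subtree? : TTree α β → List ℕ → Option (TTree α β)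
  | t, [] => some t
  | t, i :: p => (t.children[i]?).bind fun c => c.subtree? p

/-- The node `s` lies on the path of the tree between the nodes `r` and `t`: it is an ancestor of
(or equal to) one of them, and every common ancestor of `r` and `t` is an ancestor of `s`. -/
def OnPath (r s t : List ℕ) : Prop :=
  (s <+: r ∨ s <+: t) ∧ ∀ c, c <+: r → c <+: t → c <+: s

/-- The tree with its bags is a tree decomposition of the graph with vertex set `V` and
adjacency `G`. -/
structure IsTreeDecomposition (V : Finset α) (G : SimpleGraph α) (T : TTree α β) : Prop where
  vertices : ∀ v, v ∈ V ↔ ∃ p t, T.subtree? p = some t ∧ v ∈ t.bag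
  edges : ∀ u v, G.Adj u v → ∃ p t, T.subtree? p = some t ∧ u ∈ t.bag ∧ v ∈ t.bag
  paths : ∀ p q s tp tq ts, T.subtree? p = some tp → T.subtree? q = some tq →
    T.subtree? s = some ts → OnPath p s q → ∀ v, v ∈ tp.bag → v ∈ tq.bag → v ∈ ts.bag

/-- A node with bag `b` and exactly one child, whose bag is `b₁`, is an introduce node. -/
abbrev IsInt (b b₁ : Finset α) : Prop := b₁ ⊆ b ∧ b.card = b₁.card + 1

/-- A node with bag `b` and exactly one child, whose bag is `b₁`, is a removal node. -/
abbrev IsRem (b b₁ : Finset α) : Prop := b ⊆ b₁ ∧ b₁.card = b.card + 1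

/-- A node with bag `b` and exactly two children, with bags `b₁` and `b₂`, is a join node. -/
abbrev IsJoin (b b₁ b₂ : Finset α) : Prop := b = b₁ ∧ b = b₂ ∧ b ≠ ∅

/-- The type of the root is leaf (with an empty bag), introduce, removal or join. -/
def HasNiceType : TTree α β → Prop
  | leaf b _ => b = ∅
  | unary b _ c => IsInt b c.bag ∨ IsRem b c.bag
  | binary b _ l r => IsJoin b l.bag r.bag

/-- Every node has one of the four types, and the bags of the leaves and the root are empty. -/
def IsNice (T : TTree α β) : Prop :=
  (∀ p t, T.subtree? p = some t → t.HasNiceType) ∧ T.bag = ∅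

/-- Dynamic programming with table algorithm `A`: each node `t` gets the table
`o(t) = A(t, ⟨o(t₁), …, o(tₗ)⟩)`. The argument `t` of `A` gives access to the bag, the type and
the input table of the node. -/
def dp (A : TTree α ι → List ο → ο) : TTree α ι → TTree α ο
  | leaf b x => leaf b (A (leaf b x) [])
  | unary b x c => unary b (A (unary b x c) [(dp A c).tab]) (dp A c)
  | binary b x l r => binary b (A (binary b x l r) [(dp A l).tab, (dp A r).tab]) (dp A l) (dp A r)

end TTree

/-- The adjacency of the primal graph; its vertex set is `atoms prog`. -/
def primalGraph (prog : Program α) : SimpleGraph α where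
  Adj a b := a ≠ b ∧ ∃ r ∈ prog, a ∈ r.atoms ∧ b ∈ r.atoms
  symm := ⟨fun _ _ h => ⟨h.1.symm, h.2.imp fun _ hr => ⟨hr.1, hr.2.2, hr.2.1⟩⟩⟩
  loopless := ⟨fun _ h => h.1 rfl⟩

/-- `T` is a nice tree decomposition of the primal graph of the program. -/
def IsNiceTD {β : Type*} (prog : Program α) (T : TTree α β) : Prop :=
  T.IsTreeDecomposition (atoms prog) (primalGraph prog) ∧ T.IsNice

/-! ### The table algorithm PHC -/

/-- A row `⟨I, 𝒫, σ⟩`. -/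
structure Row (α : Type*) where
  interp : Finset α
  proven : Finset α
  order : List α
  deriving DecidableEq

abbrev Table (α : Type*) := Finset (Row α)

/-- The row `⟨∅, ∅, ⟨⟩⟩`. -/
def Row.empty (α : Type*) : Row α := ⟨∅, ∅, []⟩

/-- The bag-program for the bag `b`. -/
def bagProgram (prog : Program α) (b : Finset α) : Program α :=
  prog.filter fun r => r.atoms ⊆ b

/-- The atoms that can be proven from the interpretation `I` and the sequence `σ`;
`[b, a] <+ σ` says that `b` occurs before `a` in `σ`. -/
def gatherProof (I : Finset α) (σ : List α) (prog : Program α) : Finset α :=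
  prog.biUnion fun r => r.head.filter fun a =>
    r.posBody ⊆ I ∧ I ∩ r.negBody = ∅ ∧ I ∩ (r.head \ {a}) = ∅ ∧
      ∀ b ∈ r.posBody, [b, a].Sublist σ

/-- The sequences obtained from `σ` by inserting an atom of `A` at some position, and `σ` itself
if `A` is empty. -/
def possOrd (σ : List α) (A : Finset α) : Finset (List α) :=
  (if A = ∅ then {σ} else ∅) ∪
    A.biUnion fun a => (Finset.range (σ.length + 1)).image fun i => σ.insertIdx i a

/-- Introduce node with bag-program `progt` and introduced atom `a`. -/
def phcInt (progt : Program α) (a : α) (τ₁ : Table α) : Table α :=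
  τ₁.biUnion fun u =>
    (({u.interp, insert a u.interp} : Finset (Finset α)).filter fun J => IsModel progt J).biUnion
      fun J => (possOrd u.order ({a} ∩ J)).image
        fun σ => ⟨J, u.proven ∪ gatherProof J σ progt, σ⟩

/-- Removal node with removed atom `a`. -/
def phcRem (a : α) (τ₁ : Table α) : Table α :=
  (τ₁.filter fun u => a ∈ u.proven ∪ ({a} \ u.interp)).image
    fun u => ⟨u.interp.erase a, u.proven.erase a, u.order.erase a⟩

/-- Join node. -/
def phcJoin (τ₁ τ₂ : Table α) : Table α :=
  ((τ₁ ×ˢ τ₂).filter fun p => p.1.interp = p.2.interp ∧ p.1.order = p.2.order).image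
    fun p => ⟨p.1.interp, p.1.proven ∪ p.2.proven, p.1.order⟩

/-- The table algorithm PHC at the root of `t`, given the tables of the children. The introduced
(removed) atom is the only element of `b \ c.bag` (of `c.bag \ b`). -/
def phc {ι : Type*} (prog : Program α) : TTree α ι → List (Table α) → Table α
  | .leaf _ _, [] => {Row.empty α}
  | .unary b _ c, [τ₁] =>
    if TTree.IsInt b c.bag then (b \ c.bag).biUnion fun a => phcInt (bagProgram prog b) a τ₁
    else if TTree.IsRem b c.bag then (c.bag \ b).biUnion fun a => phcRem a τ₁
    else ∅
  | .binary b _ l r, [τ₁, τ₂] =>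
    if TTree.IsJoin b l.bag r.bag then phcJoin τ₁ τ₂ else ∅
  | _, _ => ∅

/-- `DP_PHC`: computes the tabled tree decomposition `(T, χ, τ)`. -/
def dpPHC {ι : Type*} (prog : Program α) : TTree α ι → TTree α (Table α) :=
  TTree.dp (phc prog)

/-! ### Origins and purging -/

/-- The set `τ₁ × ⋯ × τₗ` of sequences of rows. -/
def rowSeqs : List (Table α) → Finset (List (Row α))
  | [] => {[]}
  | τ :: τs => (τ ×ˢ rowSeqs τs).image fun p => p.1 :: p.2

/-- The originating rows of the row `u` at the root of `t`, with respect to the tables stored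
in `t`. -/
def orig (prog : Program α) (t : TTree α (Table α)) (u : Row α) : Finset (List (Row α)) :=
  (rowSeqs (t.children.map TTree.tab)).filter fun s => u ∈ phc prog t (s.map fun v => {v})

/-- The origins of a table. -/
def origs (prog : Program α) (t : TTree α (Table α)) (ρ : Table α) : Finset (List (Row α)) :=
  ρ.biUnion (orig prog t)

/-- The set of `i`-th elements of the sequences in `O` (positions counted from `0`). -/
def nthRows (O : Finset (List (Row α))) (i : ℕ) : Table α :=
  O.biUnion fun s => (s[i]?).toFinset

/-- Purging below a node `t` whose purged table is `ν`: in pre-order, each child keeps exactly the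
rows that occur in the origins of the rows kept at its parent. -/
def purgeFrom (prog : Program α) : TTree α (Table α) → Table α → TTree α (Table α)
  | .leaf b _, ν => .leaf b ν
  | .unary b τ c, ν =>
    .unary b ν (purgeFrom prog c (nthRows (origs prog (.unary b τ c) ν) 0))
  | .binary b τ l r, ν =>
    .binary b ν (purgeFrom prog l (nthRows (origs prog (.binary b τ l r) ν) 0))
      (purgeFrom prog r (nthRows (origs prog (.binary b τ l r) ν) 1))

/-- The purged tabled tree decomposition `(T, χ, ν)`: `ν(t)` consists of the rows obtained by
recursively following the origins of the rows of the root table. -/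
def purge (prog : Program α) (T : TTree α (Table α)) : TTree α (Table α) :=
  purgeFrom prog T T.tab

/-! ### The table algorithm PROJ -/

/-- The equivalence classes of `ρ` under equality of the interpretation parts restricted to `P`. -/
def buckets (P : Finset α) (ρ : Table α) : Finset (Table α) :=
  ρ.image fun u => ρ.filter fun v => v.interp ∩ P = u.interp ∩ P

/-- The non-empty subsets of the equivalence classes. -/
def subBuckets (P : Finset α) (ρ : Table α) : Finset (Table α) :=
  (buckets P ρ).biUnion fun B => B.powerset.erase ∅

/-- Tables of pairs `⟨ρ, c⟩`. -/
abbrev ProjTable (α : Type*) := Finset (Table α × ℕ)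

/-- The stored `ipmc` of `ρ` in the table `π`. -/
def sipmc (π : ProjTable α) (ρ : Table α) : ℕ :=
  ∑ x ∈ π.filter (fun x => x.1 = ρ), x.2

/-- The stored `ipmc` of a set of sequences of rows, for a sequence of tables. -/
def sipmcSeq (πs : List (ProjTable α)) (O : Finset (List (Row α))) : ℕ :=
  ∏ i ∈ Finset.range πs.length, sipmc (πs.getD i ∅) (nthRows O i)

/-- The projected count `pmc(t, ρ, ⟨π(t₁), …⟩)`, by inclusion-exclusion over the origins. -/
def pmc (prog : Program α) (t : TTree α (Table α)) (πs : List (ProjTable α)) (ρ : Table α) : ℤ :=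
  ∑ O ∈ (origs prog t ρ).powerset.erase ∅, (-1) ^ (O.card - 1) * (sipmcSeq πs O : ℤ)

/-- The intersection count `ipmc(t, ρ, ⟨π(t₁), …⟩)`: it is `1` at a leaf, and otherwise the absolute
value of `pmc(t, ρ) + ∑_{∅ ⊊ φ ⊊ ρ} (-1) ^ |φ| ipmc(t, φ)`. -/
def ipmc (prog : Program α) (t : TTree α (Table α)) (πs : List (ProjTable α)) (ρ : Table α) : ℕ :=
  if t.children.isEmpty then 1
  else (pmc prog t πs ρ +
    ∑ φ ∈ (ρ.ssubsets.erase ∅).attach, (-1) ^ φ.1.card * (ipmc prog t πs φ.1 : ℤ)).natAbs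
  termination_by ρ.card
  decreasing_by
    exact Finset.card_lt_card (Finset.mem_ssubsets.mp (Finset.mem_of_mem_erase φ.2))

/-- The table algorithm PROJ at the root of `t`, whose stored table is the purged table. -/
def proj (prog : Program α) (P : Finset α) (t : TTree α (Table α))
    (πs : List (ProjTable α)) : ProjTable α :=
  (subBuckets P t.tab).image fun ρ => (ρ, ipmc prog t πs ρ)

/-- `DP_PROJ`: computes `(T, χ, π)` from the purged `(T, χ, ν)`. -/
def dpPROJ (prog : Program α) (P : Finset α) : TTree α (Table α) → TTree α (ProjTable α) :=
  TTree.dp (proj prog P)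

/-- The algorithm `MDP_PHC` on the instance `(prog, P)`, run with the tree decomposition `T`. The
result is the count stored at the root for the table that consists of the row `⟨∅, ∅, ⟨⟩⟩` (and `0`
if none is stored). -/
def mdpPHC {ι : Type*} (prog : Program α) (P : Finset α) (T : TTree α ι) : ℕ :=
  sipmc (dpPROJ prog P (purge prog (dpPHC prog T))).tab {Row.empty α}

end PASP

/-!
For a head-cycle-free program, the answer sets are the models `I` that admit a *proof order*: an
ordering of `I` in which every atom is the only true head atom of some rule whose positive body
precedes it and whose negative body is false. If a model of the reduct were smaller than `I`, the
first missing atom in such an order would violate its rule. If no rule proves a further atom from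
the atoms proven so far, then removing from `I` a source component of the positive dependency
digraph among the unproven atoms gives a smaller model of the reduct.

A rule is a clique of the primal graph, so its atoms lie in a common bag. Hence being a model and
having a proof order can be checked bag by bag, where the orderings of the bags merge into one
ordering of `I` since at each join the orders below the two children agree on the overlap. The rows
of the table at a node are therefore the traces on the bag of the sets of atoms below that node
which satisfy all rules below it and in which all removed atoms are proven.

Purging does not change the origins of the remaining rows. A projection below a node is determined
by its trace on the bag and its traces below the children, and the latter can be chosen
independently among the projections for the rows of an origin. Hence the product stored for a set
of origins counts the projections common to them, `pmc` counts the union of these sets of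
projections, and, by inclusion-exclusion, `ipmc` counts the projections common to all given rows.
-/

namespace PASP

/-! ### Nice trees -/

namespace TTree

section Subtrees

variable {α β : Type*} {T c t : TTree α β} {i : ℕ} {p : List ℕ} {B : Finset α} {v : α}

@[simp] theorem bag_leaf (b : Finset α) (x : β) : (leaf b x).bag = b := rfl

@[simp] theorem bag_unary (b : Finset α) (x : β) (c : TTree α β) : (unary b x c).bag = b := rfl

@[simp] theorem bag_binary (b : Finset α) (x : β) (l r : TTree α β) :
    (binary b x l r).bag = b := rfl

@[simp] theorem children_leaf (b : Finset α) (x : β) : (leaf b x).children = [] := rfl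

@[simp] theorem children_unary (b : Finset α) (x : β) (c : TTree α β) :
    (unary b x c).children = [c] := rfl

@[simp] theorem children_binary (b : Finset α) (x : β) (l r : TTree α β) :
    (binary b x l r).children = [l, r] := rfl

theorem subtree?_nil (T : TTree α β) : T.subtree? [] = some T := by cases T <;> rfl

theorem subtree?_cons (h : T.children[i]? = some c) (p : List ℕ) :
    T.subtree? (i :: p) = c.subtree? p := by
  simp [subtree?, h]

theorem subtree?_eq_some_iff :
    T.subtree? p = some t ↔ (p = [] ∧ t = T) ∨
      ∃ i c q, p = i :: q ∧ T.children[i]? = some c ∧ c.subtree? q = some t := by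
  rcases p with _ | ⟨i, q⟩
  · simp [subtree?_nil, eq_comm]
  · simp only [subtree?, Option.bind_eq_some_iff]
    grind

@[elab_as_elim]
theorem children_induction {motive : TTree α β → Prop}
    (step : ∀ T : TTree α β, (∀ c ∈ T.children, motive c) → motive T) (T : TTree α β) :
    motive T := by
  induction T with
  | leaf b x => exact step _ (by simp)
  | unary b x c ih => exact step _ (by simpa using ih)
  | binary b x l r ihl ihr => exact step _ (by simpa using ⟨ihl, ihr⟩)

/-- The bags of the nodes of the tree. -/
def bags (T : TTree α β) : Set (Finset α) := {B | ∃ p t, T.subtree? p = some t ∧ t.bag = B}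

theorem bag_mem_bags (T : TTree α β) : T.bag ∈ T.bags := ⟨[], T, subtree?_nil T, rfl⟩

theorem mem_bags_iff : B ∈ T.bags ↔ B = T.bag ∨ ∃ c ∈ T.children, B ∈ c.bags := by
  simp only [bags, Set.mem_ofPred_eq, subtree?_eq_some_iff (T := T), List.mem_iff_getElem?]
  grind

/-- All nodes of the tree are leaf, introduce, removal or join nodes. -/
def NodesNice (T : TTree α β) : Prop := ∀ p t, T.subtree? p = some t → t.HasNiceType

theorem nodesNice_iff : T.NodesNice ↔ T.HasNiceType ∧ ∀ c ∈ T.children, c.NodesNice := by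
  constructor
  · intro h
    refine ⟨h [] T (subtree?_nil T), fun c hc p t hp => ?_⟩
    obtain ⟨i, hi⟩ := List.mem_iff_getElem?.1 hc
    exact h (i :: p) t (by rw [subtree?_cons hi, hp])
  · rintro ⟨hT, hchild⟩ p t hp
    rcases subtree?_eq_some_iff.1 hp with ⟨-, rfl⟩ | ⟨i, c, q, -, hi, hq⟩
    · exact hT
    · exact hchild c (List.mem_of_getElem? hi) q t hq

theorem onPath_nil_left_iff {s t : List ℕ} : OnPath [] s t ↔ s <+: t := by
  refine ⟨fun h => h.1.elim (fun hs => List.prefix_nil.1 hs ▸ List.nil_prefix) id,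
    fun h => ⟨.inr h, fun c hc _ => List.prefix_nil.1 hc ▸ List.nil_prefix⟩⟩

theorem onPath_comm {r s t : List ℕ} : OnPath r s t ↔ OnPath t s r :=
  and_congr or_comm ⟨fun h c hr ht => h c ht hr, fun h c hr ht => h c ht hr⟩

theorem onPath_cons_iff {r s t : List ℕ} :
    OnPath (i :: r) (i :: s) (i :: t) ↔ OnPath r s t := by
  simp only [OnPath, List.cons_prefix_cons, true_and]
  refine and_congr_right fun _ => ⟨fun h c hr ht => ?_, fun h c hr ht => ?_⟩
  · simpa using h (i :: c) (by simpa using hr) (by simpa using ht)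
  · rcases c with _ | ⟨j, c⟩
    · exact List.nil_prefix
    · rw [List.cons_prefix_cons] at hr ht ⊢
      exact ⟨hr.1, h c hr.2 ht.2⟩

theorem onPath_nil_of_ne {j : ℕ} (hij : i ≠ j) (r t : List ℕ) :
    OnPath (i :: r) [] (j :: t) := by
  refine ⟨.inl List.nil_prefix, fun c hr ht => ?_⟩
  rcases c with _ | ⟨k, c⟩
  · exact List.nil_prefix
  · rw [List.cons_prefix_cons] at hr ht
    exact absurd (hr.1.symm.trans ht.1) hij

/-- The connectedness condition of tree decompositions: a bag contains the common vertices of any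
two bags between which it lies. -/
def BagsConnected (T : TTree α β) : Prop :=
  ∀ p q s tp tq ts, T.subtree? p = some tp → T.subtree? q = some tq →
    T.subtree? s = some ts → OnPath p s q → ∀ v, v ∈ tp.bag → v ∈ tq.bag → v ∈ ts.bag

theorem BagsConnected.child (hT : T.BagsConnected) (h : T.children[i]? = some c) :
    c.BagsConnected := fun p q s tp tq ts hp hq hs hon =>
  hT (i :: p) (i :: q) (i :: s) tp tq ts (by rw [subtree?_cons h, hp])
    (by rw [subtree?_cons h, hq]) (by rw [subtree?_cons h, hs]) (onPath_cons_iff.2 hon)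

theorem bagsConnected_leaf (b : Finset α) (x : β) : (leaf b x).BagsConnected := by
  have hroot : ∀ {p t}, (leaf b x).subtree? p = some t → t = leaf b x := fun hp => by
    rcases subtree?_eq_some_iff.1 hp with ⟨-, rfl⟩ | ⟨i, d, q, -, hd, -⟩
    · rfl
    · simp at hd
  intro p q s tp tq ts hp _ hs _ v hvp _
  rwa [hroot hs, ← hroot hp]

end Subtrees

section Cover

variable {α β : Type*} [DecidableEq α] {T c : TTree α β} {v : α}

/-- The union of the bags of the tree. -/
def cover : TTree α β → Finset α
  | leaf b _ => b
  | unary b _ c => b ∪ c.cover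
  | binary b _ l r => b ∪ (l.cover ∪ r.cover)

theorem mem_cover_iff_child : v ∈ T.cover ↔ v ∈ T.bag ∨ ∃ c ∈ T.children, v ∈ c.cover := by
  cases T <;> simp [cover]

theorem mem_cover : v ∈ T.cover ↔ ∃ B ∈ T.bags, v ∈ B := by
  induction T using children_induction with
  | step T ih =>
    simp only [mem_cover_iff_child (T := T), mem_bags_iff (T := T)]
    grind

theorem mem_cover_iff_subtree : v ∈ T.cover ↔ ∃ p t, T.subtree? p = some t ∧ v ∈ t.bag := by
  rw [mem_cover]
  exact ⟨fun ⟨_, ⟨p, t, hp, hB⟩, hv⟩ => ⟨p, t, hp, hB ▸ hv⟩,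
    fun ⟨p, t, hp, hv⟩ => ⟨_, ⟨p, t, hp, rfl⟩, hv⟩⟩

theorem bag_subset_cover (T : TTree α β) : T.bag ⊆ T.cover := fun _ hv =>
  mem_cover_iff_child.2 (.inl hv)

theorem cover_subset_of_mem_children (h : c ∈ T.children) : c.cover ⊆ T.cover := fun _ hv =>
  mem_cover_iff_child.2 (.inr ⟨c, h, hv⟩)

theorem BagsConnected.bag_inter_cover_subset (hT : T.BagsConnected) (hc : c ∈ T.children) :
    T.bag ∩ c.cover ⊆ c.bag := by
  intro v hv
  obtain ⟨hvT, hvc⟩ := Finset.mem_inter.1 hv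
  obtain ⟨i, hi⟩ := List.mem_iff_getElem?.1 hc
  obtain ⟨p, t, hp, hvt⟩ := mem_cover_iff_subtree.1 hvc
  exact hT [] (i :: p) [i] T t c (subtree?_nil T) (by rw [subtree?_cons hi, hp])
    (by rw [subtree?_cons hi, subtree?_nil]) (onPath_nil_left_iff.2 (by simp)) v hvT hvt

theorem BagsConnected.cover_inter_cover_subset {d : TTree α β} {i j : ℕ} (hT : T.BagsConnected)
    (hij : i ≠ j) (hi : T.children[i]? = some c) (hj : T.children[j]? = some d) :
    c.cover ∩ d.cover ⊆ T.bag := by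
  intro v hv
  obtain ⟨hvc, hvd⟩ := Finset.mem_inter.1 hv
  obtain ⟨p, t, hp, hvt⟩ := mem_cover_iff_subtree.1 hvc
  obtain ⟨q, t', hq, hvt'⟩ := mem_cover_iff_subtree.1 hvd
  exact hT (i :: p) (j :: q) [] t t' T (by rw [subtree?_cons hi, hp])
    (by rw [subtree?_cons hj, hq]) (subtree?_nil T) (onPath_nil_of_ne hij p q) v hvt hvt'

/-- Inductive form of "nice tree decomposition": each node is a leaf, introduce, removal or join
node, and the connectedness condition is stated locally, through the covers of the children. The
root bag need not be empty. -/
inductive NiceTree : TTree α β → Prop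
  | leaf (x : β) : NiceTree (leaf ∅ x)
  | introduce (a : α) (x : β) (c : TTree α β) (ha : a ∉ c.cover) (hc : NiceTree c) :
      NiceTree (unary (insert a c.bag) x c)
  | removal (a : α) (x : β) (c : TTree α β) (ha : a ∈ c.bag) (hc : NiceTree c) :
      NiceTree (unary (c.bag.erase a) x c)
  | join (b : Finset α) (x : β) (l r : TTree α β) (hbl : l.bag = b) (hbr : r.bag = b)
      (hne : b ≠ ∅) (hlr : l.cover ∩ r.cover ⊆ b) (hl : NiceTree l) (hr : NiceTree r) :
      NiceTree (binary b x l r)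

theorem niceTree_of_bagsConnected (hT : T.BagsConnected) (hn : T.NodesNice) : NiceTree T := by
  induction T with
  | leaf b x =>
    obtain rfl : b = ∅ := (nodesNice_iff.1 hn).1
    exact .leaf x
  | unary b x c ih =>
    have hroot : IsInt b c.bag ∨ IsRem b c.bag := (nodesNice_iff.1 hn).1
    have hc : c.NiceTree :=
      ih (hT.child (i := 0) rfl) ((nodesNice_iff.1 hn).2 c (by simp))
    rcases hroot with ⟨hsub, hcard⟩ | ⟨hsub, hcard⟩
    · obtain ⟨a, ha, rfl⟩ := Finset.exists_eq_insert_iff.2 ⟨hsub, hcard.symm⟩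
      exact .introduce a x c (fun h => ha (hT.bag_inter_cover_subset (by simp)
        (Finset.mem_inter.2 ⟨Finset.mem_insert_self a _, h⟩))) hc
    · obtain ⟨a, ha, hab⟩ := Finset.exists_eq_insert_iff.2 ⟨hsub, hcard.symm⟩
      obtain rfl : b = c.bag.erase a := by rw [← hab, Finset.erase_insert ha]
      exact .removal a x c (hab ▸ Finset.mem_insert_self a _) hc
  | binary b x l r ihl ihr =>
    obtain ⟨⟨hl, hr, hb⟩, hnice⟩ := nodesNice_iff.1 hn
    exact .join b x l r hl.symm hr.symm hb
      (hT.cover_inter_cover_subset zero_ne_one rfl rfl)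
      (ihl (hT.child (i := 0) rfl) (hnice l (by simp)))
      (ihr (hT.child (i := 1) rfl) (hnice r (by simp)))

namespace NiceTree

theorem child (hT : T.NiceTree) (hc : c ∈ T.children) : c.NiceTree := by
  cases hT <;> simp only [children_leaf, children_unary, children_binary, List.mem_cons] at hc <;>
    grind

theorem bag_inter_cover_subset (hT : T.NiceTree) (hc : c ∈ T.children) :
    T.bag ∩ c.cover ⊆ c.bag := by
  have := c.bag_subset_cover
  cases hT <;> simp only [children_leaf, children_unary, children_binary, List.mem_cons, bag_leaf,
    bag_unary, bag_binary] at hc ⊢ <;> grind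

theorem eq_of_mem_cover_of_notMem_bag {i j : ℕ} {d : TTree α β} (hT : T.NiceTree)
    (hc : T.children[i]? = some c) (hd : T.children[j]? = some d) (hvc : v ∈ c.cover)
    (hvd : v ∈ d.cover) (hv : v ∉ T.bag) : i = j := by
  cases hT <;> simp only [children_leaf, children_unary, children_binary, bag_leaf, bag_unary,
    bag_binary] at hc hd hv <;> grind

end NiceTree

end Cover

section Decompositions

variable {α β : Type*} [DecidableEq α] {T c : TTree α β} {v : α}

theorem NiceTree.mem_bags_child {B : Finset α} (hT : T.NiceTree) (hc : c ∈ T.children)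
    (hB : B ∈ T.bags) (hvB : v ∈ B) (hvc : v ∈ c.cover) (hv : v ∉ T.bag) : B ∈ c.bags := by
  rcases mem_bags_iff.1 hB with rfl | ⟨d, hd, hBd⟩
  · exact absurd hvB hv
  · obtain ⟨i, hi⟩ := List.mem_iff_getElem?.1 hc
    obtain ⟨j, hj⟩ := List.mem_iff_getElem?.1 hd
    obtain rfl := hT.eq_of_mem_cover_of_notMem_bag hi hj hvc (mem_cover.2 ⟨B, hBd, hvB⟩) hv
    rwa [Option.some.inj (hi.symm.trans hj)]

/-- The Helly property of subtrees: every clique lies in a bag. -/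
theorem NiceTree.exists_bag_of_pairwise (hT : T.NiceTree) {S : Finset α}
    (hS : ∀ u ∈ S, ∀ v ∈ S, ∃ B ∈ T.bags, u ∈ B ∧ v ∈ B) : ∃ B ∈ T.bags, S ⊆ B := by
  induction T using children_induction with
  | step T ih =>
    by_cases hST : S ⊆ T.bag
    · exact ⟨T.bag, T.bag_mem_bags, hST⟩
    obtain ⟨y, hyS, hyT⟩ := Finset.not_subset.1 hST
    obtain ⟨c, hc, hyc⟩ : ∃ c ∈ T.children, y ∈ c.cover := by
      obtain ⟨B, hB, hyB, -⟩ := hS y hyS y hyS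
      exact (mem_cover_iff_child.1 (mem_cover.2 ⟨B, hB, hyB⟩)).resolve_left hyT
    have hSc : ∀ v ∈ S, v ∈ c.cover := fun v hv => by
      obtain ⟨B, hB, hyB, hvB⟩ := hS y hyS v hv
      exact mem_cover.2 ⟨B, hT.mem_bags_child hc hB hyB hyc hyT, hvB⟩
    have hchild : ∀ u ∈ S, ∀ v ∈ S, ∃ B ∈ c.bags, u ∈ B ∧ v ∈ B := fun u hu v hv => by
      obtain ⟨B, hB, huB, hvB⟩ := hS u hu v hv
      by_cases huT : u ∈ T.bag
      · by_cases hvT : v ∈ T.bag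
        · exact ⟨c.bag, c.bag_mem_bags,
            hT.bag_inter_cover_subset hc (Finset.mem_inter.2 ⟨huT, hSc u hu⟩),
            hT.bag_inter_cover_subset hc (Finset.mem_inter.2 ⟨hvT, hSc v hv⟩)⟩
        · exact ⟨B, hT.mem_bags_child hc hB hvB (hSc v hv) hvT, huB, hvB⟩
      · exact ⟨B, hT.mem_bags_child hc hB huB (hSc u hu) huT, huB, hvB⟩
    obtain ⟨B, hB, hSB⟩ := ih c hc (hT.child hc) hchild
    exact ⟨B, mem_bags_iff.2 (.inr ⟨c, hc, hB⟩), hSB⟩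

theorem BagsConnected.unary (hc : c.BagsConnected) {b : Finset α} (x : β)
    (hb : b ∩ c.cover ⊆ c.bag) : (unary b x c).BagsConnected := by
  have hsub : ∀ {p t}, (TTree.unary b x c).subtree? p = some t →
      (p = [] ∧ t = .unary b x c) ∨ ∃ q, p = 0 :: q ∧ c.subtree? q = some t := fun hp => by
    rcases subtree?_eq_some_iff.1 hp with h | ⟨_ | i, d, q, rfl, hd, hq⟩
    · exact .inl h
    · obtain rfl : c = d := by simpa using hd
      exact .inr ⟨q, rfl, hq⟩
    · simp at hd
  have hroot : ∀ {q s : List ℕ} {tq ts}, c.subtree? q = some tq → c.subtree? s = some ts →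
      OnPath [] (0 :: s) (0 :: q) → ∀ v, v ∈ b → v ∈ tq.bag → v ∈ ts.bag := by
    intro q s tq ts hq hs hon v hv hvq
    rw [onPath_nil_left_iff, List.cons_prefix_cons] at hon
    exact hc [] q s c tq ts (subtree?_nil c) hq hs (onPath_nil_left_iff.2 hon.2) v
      (hb (Finset.mem_inter.2 ⟨hv, mem_cover_iff_subtree.2 ⟨q, tq, hq, hvq⟩⟩)) hvq
  intro p q s tp tq ts hp hq hs hon v hvp hvq
  rcases hsub hs with ⟨rfl, rfl⟩ | ⟨s', rfl, hs'⟩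
  · rcases hsub hp with ⟨rfl, rfl⟩ | ⟨p', rfl, -⟩
    · exact hvp
    · rcases hsub hq with ⟨rfl, rfl⟩ | ⟨q', rfl, -⟩
      · exact hvq
      · simpa using hon.2 [0] (by simp) (by simp)
  · rcases hsub hp with ⟨rfl, rfl⟩ | ⟨p', rfl, hp'⟩ <;>
      rcases hsub hq with ⟨rfl, rfl⟩ | ⟨q', rfl, hq'⟩
    · simp [onPath_nil_left_iff] at hon
    · exact hroot hq' hs' hon v hvp hvq
    · exact hroot hp' hs' (onPath_comm.1 hon) v hvq hvp
    · exact hc p' q' s' tp tq ts hp' hq' hs' (onPath_cons_iff.1 hon) v hvp hvq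

theorem exists_introduce_chain (V : Finset α) : ∃ T : TTree α Unit, T.BagsConnected ∧
    T.NodesNice ∧ T.bag = V ∧ T.cover = V := by
  induction V using Finset.induction_on with
  | empty =>
    exact ⟨leaf ∅ (), bagsConnected_leaf _ _, nodesNice_iff.2 ⟨rfl, by simp⟩, rfl, rfl⟩
  | insert a V ha ih =>
    obtain ⟨T, hconn, hnice, hbag, hcover⟩ := ih
    have hV := Finset.subset_insert a V
    refine ⟨TTree.unary (insert a V) () T, hconn.unary () (by simp [hbag, hcover]),
      nodesNice_iff.2 ⟨.inl ?_, by simpa using hnice⟩, rfl, ?_⟩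
    · rw [hbag]
      exact ⟨hV, Finset.card_insert_of_notMem ha⟩
    · rw [cover, hcover, Finset.union_eq_left.2 hV]

theorem exists_removal_chain {S : Finset α} {T : TTree α Unit} (hconn : T.BagsConnected)
    (hnice : T.NodesNice) (hbag : T.bag = S) : ∃ T' : TTree α Unit, T'.BagsConnected ∧
    T'.NodesNice ∧ T'.bag = ∅ ∧ T'.cover = T.cover ∧ T.bags ⊆ T'.bags := by
  induction S using Finset.induction_on generalizing T with
  | empty => exact ⟨T, hconn, hnice, hbag, rfl, subset_rfl⟩
  | insert a S ha ih =>
    have hS : S ⊆ T.bag := hbag ▸ Finset.subset_insert a S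
    obtain ⟨T', hconn', hnice', hbag', hcover, hbags⟩ := ih (T := TTree.unary S () T)
      (hconn.unary () (Finset.inter_subset_left.trans hS))
      (nodesNice_iff.2 ⟨.inr ⟨hS, hbag ▸ Finset.card_insert_of_notMem ha⟩, by simpa using hnice⟩)
      rfl
    refine ⟨T', hconn', hnice', hbag', hcover.trans ?_,
      fun B hB => hbags (mem_bags_iff.2 (.inr ⟨T, by simp, hB⟩))⟩
    exact Finset.union_eq_right.2 (hS.trans T.bag_subset_cover)

end Decompositions

end TTree

section NiceDecompositions

variable {α β : Type*} [DecidableEq α] {prog : Program α} {T : TTree α β}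

theorem exists_isNiceTD (prog : Program α) : ∃ T : TTree α Unit, IsNiceTD prog T := by
  obtain ⟨T, hconn, hnice, hbag, hcover⟩ := TTree.exists_introduce_chain (atoms prog)
  obtain ⟨T', hconn', hnice', hbag', hcover', hbags⟩ := TTree.exists_removal_chain hconn hnice hbag
  obtain ⟨p, t, hp, ht⟩ := hbags T.bag_mem_bags
  refine ⟨T', ⟨fun v => ?_, fun u v huv => ?_, hconn'⟩, hnice', hbag'⟩
  · rw [← TTree.mem_cover_iff_subtree, hcover', hcover]
  · obtain ⟨-, r, hr, hu, hv⟩ := huv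
    exact ⟨p, t, hp, by rw [ht, hbag]; exact
      ⟨Finset.mem_biUnion.2 ⟨r, hr, hu⟩, Finset.mem_biUnion.2 ⟨r, hr, hv⟩⟩⟩

theorem IsNiceTD.niceTree (h : IsNiceTD prog T) : T.NiceTree :=
  TTree.niceTree_of_bagsConnected h.1.paths h.2.1

theorem IsNiceTD.cover_eq (h : IsNiceTD prog T) : T.cover = atoms prog := by
  ext v
  rw [h.1.vertices, TTree.mem_cover_iff_subtree]

theorem IsNiceTD.exists_bag_of_mem (h : IsNiceTD prog T) {r : Rule α} (hr : r ∈ prog) :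
    ∃ B ∈ T.bags, r.atoms ⊆ B := by
  refine h.niceTree.exists_bag_of_pairwise fun u hu v hv => ?_
  obtain rfl | huv := eq_or_ne u v
  · have hu' : u ∈ T.cover := h.cover_eq ▸ Finset.mem_biUnion.2 ⟨r, hr, hu⟩
    obtain ⟨B, hB, huB⟩ := TTree.mem_cover.1 hu'
    exact ⟨B, hB, huB, huB⟩
  · obtain ⟨p, t, hp, hut, hvt⟩ := h.1.edges u v ⟨huv, r, hr, hu, hv⟩
    exact ⟨_, ⟨p, t, hp, rfl⟩, hut, hvt⟩

end NiceDecompositions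

/-! ### Answer sets of head-cycle-free programs -/

section Components

variable {α : Type*}

theorem exists_source_component {R : α → α → Prop} (hrefl : ∀ x, R x x)
    (htrans : ∀ {x y z}, R x y → R y z → R x z) {N : Finset α} (hN : N.Nonempty) :
    ∃ U ⊆ N, U.Nonempty ∧ (∀ x ∈ U, ∀ y ∈ U, R x y) ∧ ∀ x ∈ N, ∀ y ∈ U, R x y → x ∈ U := by
  classical
  let _ : Preorder α := { le := R, le_refl := hrefl, le_trans := fun _ _ _ => htrans }
  obtain ⟨m, hm⟩ := N.exists_minimal hN
  refine ⟨N.filter (R · m), Finset.filter_subset _ _, ⟨m, by simp [hm.1, hrefl]⟩, ?_, ?_⟩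
  · intro x hx y hy
    rw [Finset.mem_filter] at hx hy
    exact htrans hx.2 (hm.2 hy.1 hy.2)
  · intro x hx y hy hxy
    exact Finset.mem_filter.2 ⟨hx, htrans hxy (Finset.mem_filter.1 hy).2⟩

theorem HeadCycleFree.eq_of_reflTransGen {prog : Program α} {r : Rule α} {b c : α}
    (hcf : HeadCycleFree prog) (hr : r ∈ prog)
    (hb : b ∈ r.head) (hc : c ∈ r.head) (hbc : Relation.ReflTransGen (DepEdge prog) b c)
    (hcb : Relation.ReflTransGen (DepEdge prog) c b) : b = c := by
  by_contra hne
  exact hcf ⟨r, hr, b, hb, c, hc, hne,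
    (Relation.reflTransGen_iff_eq_or_transGen.1 hbc).resolve_left (Ne.symm hne),
    (Relation.reflTransGen_iff_eq_or_transGen.1 hcb).resolve_left hne⟩

end Components

section AnswerSets

variable {α : Type*}

theorem mem_of_pair_sublist_append {b c : α} {l l' : List α} (hnd : (l ++ c :: l').Nodup)
    (h : [b, c].Sublist (l ++ c :: l')) : b ∈ l := by
  obtain ⟨r₁, r₂, heq, hb, hc⟩ := List.cons_sublist_iff.1 h
  rw [List.singleton_sublist] at hc
  rcases List.append_eq_append_iff.1 heq with ⟨_ | ⟨a, as⟩, rfl, has⟩ | ⟨as, rfl, -⟩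
  · simpa using hb
  · obtain ⟨-, rfl⟩ : c = a ∧ l' = as ++ r₂ := by simpa using has
    simp [List.nodup_middle, hc] at hnd
  · exact List.mem_append_left as hb

variable [DecidableEq α] {prog : Program α} {I J : Finset α} {σ σ' : List α}
  {r : Rule α} {b c : α}

/-- The rule `r` proves the atom `c` from the interpretation `I` along the sequence `σ`: it is the
condition under which `gatherProof` collects `c`. -/
def Rule.Proves (r : Rule α) (I : Finset α) (σ : List α) (c : α) : Prop :=
  c ∈ r.head ∧ r.posBody ⊆ I ∧ I ∩ r.negBody = ∅ ∧ I ∩ (r.head \ {c}) = ∅ ∧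
    ∀ b ∈ r.posBody, [b, c].Sublist σ

theorem mem_gatherProof : c ∈ gatherProof I σ prog ↔ ∃ r ∈ prog, r.Proves I σ c := by
  simp [gatherProof, Rule.Proves]

theorem Rule.Proves.mono (h : r.Proves I σ c) (hσ : σ.Sublist σ') : r.Proves I σ' c :=
  ⟨h.1, h.2.1, h.2.2.1, h.2.2.2.1, fun b hb => (h.2.2.2.2 b hb).trans hσ⟩

theorem Rule.Proves.eq_of_mem_head (h : r.Proves I σ c) (hb : b ∈ r.head) (hbI : b ∈ I) :
    b = c := by
  by_contra hbc
  have : b ∈ I ∩ (r.head \ {c}) := by simp [hb, hbc, hbI]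
  simp [h.2.2.2.1] at this

theorem Rule.sat_iff :
    r.Sat I ↔ (r.posBody ⊆ I → Disjoint r.negBody I → ∃ c ∈ r.head, c ∈ I) := by
  rw [Rule.Sat, Finset.sdiff_nonempty, Finset.disjoint_left]
  simp only [Finset.Nonempty, Finset.mem_inter, Finset.mem_union]
  grind

theorem isModel_reduct_iff :
    IsModel (reduct prog I) J ↔
      ∀ r ∈ prog, Disjoint r.negBody I → r.posBody ⊆ J → ∃ c ∈ r.head, c ∈ J := by
  simp only [IsModel, reduct, Rule.sat_iff, Finset.forall_mem_image, Finset.mem_filter, and_imp,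
    Rule.positivePart, Finset.disjoint_empty_left, true_implies]

/-- The interpretation `I` is a model, listed without repetition by `σ`, all of whose atoms are
proven along `σ`. -/
structure IsProvenModel (prog : Program α) (I : Finset α) (σ : List α) : Prop where
  isModel : IsModel prog I
  nodup : σ.Nodup
  mem_iff : ∀ c, c ∈ σ ↔ c ∈ I
  proves : ∀ c ∈ I, ∃ r ∈ prog, r.Proves I σ c

/-- The atoms of a model of the reduct are collected in the order in which they are proven. -/
theorem IsProvenModel.isAnswerSet (h : IsProvenModel prog I σ) : IsAnswerSet prog I := by
  refine ⟨isModel_reduct_iff.2 fun r hr hneg hpos => Rule.sat_iff.1 (h.isModel r hr) hpos hneg,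
    fun J hJ hJI => ?_⟩
  have hprefix : ∀ l l', σ = l ++ l' → ∀ c ∈ l, c ∈ J := by
    intro l
    induction l using List.reverseRecOn with
    | nil => simp
    | append_singleton l c ih =>
      intro l' hl
      rw [List.append_assoc, List.singleton_append] at hl
      have hcI : c ∈ I := (h.mem_iff c).1 (by simp [hl])
      obtain ⟨r, hr, hproves⟩ := h.proves c hcI
      obtain ⟨d, hd, hdJ⟩ := isModel_reduct_iff.1 hJ r hr
        (Finset.disjoint_iff_inter_eq_empty.2 (Finset.inter_comm I _ ▸ hproves.2.2.1))
        fun b hb => ih _ hl b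
          (mem_of_pair_sublist_append (hl ▸ h.nodup) (hl ▸ hproves.2.2.2.2 b hb))
      have hcJ : c ∈ J := hproves.eq_of_mem_head hd (hJI hdJ) ▸ hdJ
      simpa [or_imp, forall_and] using ⟨ih _ hl, hcJ⟩
  exact fun c hc => hprefix σ [] (by simp) c ((h.mem_iff c).2 hc)

/-- A repetition-free sequence of atoms of `I`, each of which is proven along the sequence. It
approximates the sequence of an `IsProvenModel` from below. -/
structure IsProofSequence (prog : Program α) (I : Finset α) (σ : List α) : Prop where
  nodup : σ.Nodup
  mem : ∀ c ∈ σ, c ∈ I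
  proves : ∀ c ∈ σ, ∃ r ∈ prog, r.Proves I σ c

theorem IsProofSequence.append (h : IsProofSequence prog I σ) (hr : r ∈ prog) (hc : c ∈ I)
    (hcσ : c ∉ σ) (hcr : c ∈ r.head) (hpos : ∀ b ∈ r.posBody, b ∈ σ)
    (hneg : I ∩ r.negBody = ∅) (hhead : I ∩ (r.head \ {c}) = ∅) :
    IsProofSequence prog I (σ ++ [c]) where
  nodup := List.nodup_append.2 ⟨h.nodup, List.nodup_singleton c, by grind⟩
  mem := by simpa [or_imp, forall_and] using ⟨h.mem, hc⟩
  proves d hd := by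
    rcases List.mem_append.1 hd with hd | hd
    · obtain ⟨r', hr', hproves⟩ := h.proves d hd
      exact ⟨r', hr', hproves.mono (List.sublist_append_left _ _)⟩
    · obtain rfl := List.mem_singleton.1 hd
      exact ⟨r, hr, hcr, fun b hb => h.mem b (hpos b hb), hneg, hhead, fun b hb =>
        (List.singleton_sublist.2 (hpos b hb)).append (List.Sublist.refl [d])⟩

theorem exists_maximal_isProofSequence (prog : Program α) (I : Finset α) :
    ∃ σ, IsProofSequence prog I σ ∧ ∀ c ∉ σ, ¬ IsProofSequence prog I (σ ++ [c]) := by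
  by_contra! hextend
  have hlong : ∀ n, ∃ σ, IsProofSequence prog I σ ∧ σ.length = n := fun n => by
    induction n with
    | zero => exact ⟨[], ⟨List.nodup_nil, by simp, by simp⟩, rfl⟩
    | succ n ih =>
      obtain ⟨σ, hσ, hn⟩ := ih
      obtain ⟨c, -, hc⟩ := hextend σ hσ
      exact ⟨σ ++ [c], hc, by simp [hn]⟩
  obtain ⟨σ, hσ, hlen⟩ := hlong (I.card + 1)
  have hcard : σ.toFinset.card ≤ I.card :=
    Finset.card_le_card fun c hc => hσ.mem c (List.mem_toFinset.1 hc)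
  rw [List.toFinset_card_of_nodup hσ.nodup] at hcard
  omega

/-- Otherwise `I \ U` would be a smaller model of the reduct. -/
theorem IsAnswerSet.exists_external_support (h : IsAnswerSet prog I) {U : Finset α}
    (hU : U.Nonempty) (hUI : U ⊆ I) : ∃ r ∈ prog, Disjoint r.negBody I ∧ r.posBody ⊆ I \ U ∧
      (∃ c ∈ r.head, c ∈ I) ∧ ∀ c ∈ r.head, c ∈ I → c ∈ U := by
  by_contra! hcon
  have hmodel : IsModel (reduct prog I) (I \ U) := isModel_reduct_iff.2 fun r hr hneg hpos => by
    obtain ⟨c, hc, hcI⟩ := isModel_reduct_iff.1 h.1 r hr hneg (hpos.trans Finset.sdiff_subset)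
    obtain ⟨d, hd, hdI, hdU⟩ := hcon r hr hneg hpos ⟨c, hc, hcI⟩
    exact ⟨d, hd, Finset.mem_sdiff.2 ⟨hdI, hdU⟩⟩
  obtain ⟨x, hx⟩ := hU
  exact (Finset.mem_sdiff.1 (h.2 hmodel Finset.sdiff_subset (hUI hx))).2 hx

theorem IsAnswerSet.exists_isProvenModel (hcf : HeadCycleFree prog) (h : IsAnswerSet prog I) :
    ∃ σ, IsProvenModel prog I σ := by
  obtain ⟨σ, hσ, hmax⟩ := exists_maximal_isProofSequence prog I
  have hall : ∀ c ∈ I, c ∈ σ := by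
    by_contra! hcon
    obtain ⟨c, hcI, hcσ⟩ := hcon
    obtain ⟨U, hUN, hU, hstrong, hsource⟩ := exists_source_component
      (R := Relation.ReflTransGen (DepEdge prog)) (fun _ => .refl) (.trans)
      (N := I.filter (· ∉ σ)) ⟨c, Finset.mem_filter.2 ⟨hcI, hcσ⟩⟩
    obtain ⟨r, hr, hneg, hpos, ⟨d, hd, hdI⟩, hheadU⟩ :=
      h.exists_external_support hU (hUN.trans (Finset.filter_subset _ _))
    have hdU := hheadU d hd hdI
    have hdσ : d ∉ σ := (Finset.mem_filter.1 (hUN hdU)).2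
    have hposσ : ∀ b ∈ r.posBody, b ∈ σ := fun b hb => by
      obtain ⟨hbI, hbU⟩ := Finset.mem_sdiff.1 (hpos hb)
      by_contra hbσ
      exact hbU (hsource b (Finset.mem_filter.2 ⟨hbI, hbσ⟩) d hdU (.single ⟨r, hr, hb, hd⟩))
    have hhead : ∀ b ∈ r.head, b ∈ I → b = d := fun b hb hbI =>
      have hbU := hheadU b hb hbI
      hcf.eq_of_reflTransGen hr hb hd (hstrong b hbU d hdU) (hstrong d hdU b hbU)
    refine hmax d hdσ (hσ.append hr hdI hdσ hd hposσ
      (Finset.disjoint_iff_inter_eq_empty.1 hneg.symm) (Finset.eq_empty_of_forall_notMem ?_))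
    intro b hb
    simp only [Finset.mem_inter, Finset.mem_sdiff, Finset.mem_singleton] at hb
    exact hb.2.2 (hhead b hb.2.1 hb.1)
  exact ⟨σ, fun r hr => Rule.sat_iff.2 fun hpos hneg => isModel_reduct_iff.1 h.1 r hr hneg hpos,
    hσ.nodup, fun c => ⟨hσ.mem c, hall c⟩, fun c hc => hσ.proves c (hall c hc)⟩

theorem isAnswerSet_iff_exists_isProvenModel (hcf : HeadCycleFree prog) :
    IsAnswerSet prog I ↔ ∃ σ, IsProvenModel prog I σ :=
  ⟨fun h => h.exists_isProvenModel hcf, fun ⟨_, h⟩ => h.isAnswerSet⟩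

end AnswerSets

/-! ### Rows of partial solutions -/

section Lists

variable {α : Type*}

theorem pair_sublist_filter_iff {p : α → Bool} {σ : List α} {b c : α} (hb : p b) (hc : p c) :
    [b, c].Sublist (σ.filter p) ↔ [b, c].Sublist σ :=
  ⟨fun h => h.trans List.filter_sublist, fun h => by simpa [hb, hc] using h.filter p⟩

/-- Two sequences that agree on the overlap of their domains have a common extension. -/
theorem exists_filter_eq_of_filter_eq {p q : α → Bool} {l₁ l₂ : List α} (h₁ : ∀ x ∈ l₁, p x)
    (h₂ : ∀ x ∈ l₂, q x) (h : l₁.filter q = l₂.filter p) :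
    ∃ l : List α, l.filter p = l₁ ∧ l.filter q = l₂ ∧ ∀ x ∈ l, p x ∨ q x := by
  generalize hl₀ : l₂.filter p = l₀ at h
  induction l₀ generalizing l₁ l₂ with
  | nil =>
    refine ⟨l₁ ++ l₂, ?_, ?_, ?_⟩
    · rw [List.filter_append, hl₀, List.filter_eq_self.2 h₁, List.append_nil]
    · rw [List.filter_append, h, List.filter_eq_self.2 h₂, List.nil_append]
    · simpa only [List.mem_append] using fun x hx => hx.imp (h₁ x) (h₂ x)
  | cons x l₀ ih =>
    obtain ⟨k₁, t₁, rfl, hk₁, hqx, ht₁⟩ := List.filter_eq_cons_iff.1 h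
    obtain ⟨k₂, t₂, rfl, hk₂, hpx, ht₂⟩ := List.filter_eq_cons_iff.1 hl₀
    simp only [List.mem_append, List.mem_cons] at h₁ h₂
    obtain ⟨m, hmp, hmq, hm⟩ := ih (fun y hy => h₁ y (by simp [hy]))
      (fun y hy => h₂ y (by simp [hy])) ht₂ ht₁
    have hk₁p : k₁.filter p = k₁ := List.filter_eq_self.2 fun y hy => h₁ y (.inl hy)
    have hk₂q : k₂.filter q = k₂ := List.filter_eq_self.2 fun y hy => h₂ y (.inl hy)
    refine ⟨k₁ ++ (k₂ ++ x :: m), ?_, ?_, ?_⟩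
    · simp [hk₁p, List.filter_eq_nil_iff.2 hk₂, hpx, hmp]
    · simp [hk₂q, List.filter_eq_nil_iff.2 hk₁, hqx, hmq]
    · simp only [List.mem_append, List.mem_cons]
      rintro y (hy | hy | rfl | hy)
      · exact .inl (h₁ y (.inl hy))
      · exact .inr (h₂ y (.inl hy))
      · exact .inl hpx
      · exact hm y hy

theorem nodup_of_nodup_filter {p q : α → Bool} {l : List α} (hp : (l.filter p).Nodup)
    (hq : (l.filter q).Nodup) (h : ∀ x ∈ l, p x ∨ q x) : l.Nodup := by
  classical
  refine List.nodup_iff_count_le_one.2 fun x => ?_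
  by_cases hx : x ∈ l
  · rcases h x hx with hpx | hqx
    · simpa only [List.count_filter hpx] using List.nodup_iff_count_le_one.1 hp x
    · simpa only [List.count_filter hqx] using List.nodup_iff_count_le_one.1 hq x
  · simp [List.count_eq_zero_of_not_mem hx]

theorem insertIdx_eq_take_append_cons_drop {l : List α} {i : ℕ} (hi : i ≤ l.length) (a : α) :
    l.insertIdx i a = l.take i ++ a :: l.drop i := by
  induction l generalizing i with
  | nil => simp [Nat.le_zero.1 hi]
  | cons x l ih =>
    cases i with
    | zero => rfl
    | succ i => simp [ih (Nat.le_of_succ_le_succ hi)]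

variable [DecidableEq α] {a : α} {σ σ' : List α} {B J : Finset α}

theorem filter_insert_of_notMem (ha : a ∉ σ) :
    σ.filter (· ∈ insert a B) = σ.filter (· ∈ B) :=
  List.filter_congr fun x hx => by simp [ne_of_mem_of_not_mem hx ha]

theorem filter_erase_of_nodup (hσ : σ.Nodup) :
    (σ.filter (· ∈ B)).erase a = σ.filter (· ∈ B.erase a) := by
  rw [(hσ.filter _).erase_eq_filter, List.filter_filter]
  exact List.filter_congr fun x _ => by by_cases hx : x = a <;> simp [hx]

theorem possOrd_inter_of_notMem (ha : a ∉ J) : possOrd σ ({a} ∩ J) = {σ} := by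
  simp [possOrd, Finset.singleton_inter_of_notMem ha]

theorem mem_possOrd_inter_of_mem (ha : a ∈ J) :
    σ' ∈ possOrd σ ({a} ∩ J) ↔ ∃ l l', σ = l ++ l' ∧ σ' = l ++ a :: l' := by
  simp only [possOrd, Finset.singleton_inter_of_mem ha, Finset.singleton_ne_empty, if_false,
    Finset.empty_union, Finset.singleton_biUnion, Finset.mem_image, Finset.mem_range]
  constructor
  · rintro ⟨i, hi, rfl⟩
    exact ⟨σ.take i, σ.drop i, (List.take_append_drop i σ).symm,
      insertIdx_eq_take_append_cons_drop (Nat.lt_succ_iff.1 hi) a⟩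
  · rintro ⟨l, l', rfl, rfl⟩
    exact ⟨l.length, by simp, by simp [insertIdx_eq_take_append_cons_drop]⟩

theorem filter_insert_mem_possOrd (hσ : σ.Nodup) (haB : a ∉ B) (haJ : a ∈ J ↔ a ∈ σ) :
    σ.filter (· ∈ insert a B) ∈ possOrd (σ.filter (· ∈ B)) ({a} ∩ J) := by
  by_cases ha : a ∈ σ
  · rw [mem_possOrd_inter_of_mem (haJ.2 ha)]
    obtain ⟨l, l', rfl⟩ := List.append_of_mem ha
    rw [List.nodup_middle, List.nodup_cons, List.mem_append, not_or] at hσ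
    refine ⟨l.filter (· ∈ B), l'.filter (· ∈ B), by simp [haB], ?_⟩
    rw [List.filter_append, List.filter_cons_of_pos (by simp),
      filter_insert_of_notMem hσ.1.1, filter_insert_of_notMem hσ.1.2]
  · rw [possOrd_inter_of_notMem (haJ.not.2 ha), filter_insert_of_notMem ha, Finset.mem_singleton]

theorem exists_filter_insert_eq (hσ : σ.Nodup) (ha : a ∉ σ)
    (h : σ' ∈ possOrd (σ.filter (· ∈ B)) ({a} ∩ J)) :
    ∃ l : List α, l.Nodup ∧ l.filter (· ∈ insert a B) = σ' ∧ l.filter (· ≠ a) = σ ∧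
      (a ∈ l ↔ a ∈ J) := by
  by_cases haJ : a ∈ J
  · obtain ⟨k, k', hk, rfl⟩ := (mem_possOrd_inter_of_mem haJ).1 h
    obtain ⟨l, l', rfl, rfl, rfl⟩ := List.filter_eq_append_iff.1 hk
    refine ⟨l ++ a :: l', List.nodup_middle.2 (List.nodup_cons.2 ⟨ha, hσ⟩), ?_, ?_, by simp [haJ]⟩
    all_goals rw [List.mem_append, not_or] at ha
    · rw [List.filter_append, List.filter_cons_of_pos (by simp), filter_insert_of_notMem ha.1,
        filter_insert_of_notMem ha.2]
    · rw [List.filter_append, List.filter_cons_of_neg (by simp), ← List.filter_append,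
        List.filter_eq_self]
      grind
  · rw [possOrd_inter_of_notMem haJ, Finset.mem_singleton] at h
    refine ⟨σ, hσ, h ▸ filter_insert_of_notMem ha, List.filter_eq_self.2 ?_, by simp [ha, haJ]⟩
    grind

end Lists

section Locality

variable {α : Type*} [DecidableEq α] {prog : Program α} {r : Rule α} {A I : Finset α}
  {σ : List α} {c : α}

theorem Rule.head_subset_atoms (r : Rule α) : r.head ⊆ r.atoms :=
  Finset.subset_union_left.trans Finset.subset_union_left

theorem Rule.posBody_subset_atoms (r : Rule α) : r.posBody ⊆ r.atoms :=
  Finset.subset_union_right.trans Finset.subset_union_left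

theorem Rule.negBody_subset_atoms (r : Rule α) : r.negBody ⊆ r.atoms :=
  Finset.subset_union_right

theorem Rule.sat_inter_iff (hr : r.atoms ⊆ A) : r.Sat (I ∩ A) ↔ r.Sat I := by
  have hhead := r.head_subset_atoms.trans hr
  have hpos := r.posBody_subset_atoms.trans hr
  have hneg := r.negBody_subset_atoms.trans hr
  have hunion : (r.head ∪ r.negBody) ∩ (I ∩ A) = (r.head ∪ r.negBody) ∩ I := by grind
  have hsdiff : r.posBody \ (I ∩ A) = r.posBody \ I := by grind
  rw [Rule.Sat, Rule.Sat, hunion, hsdiff]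

theorem Rule.proves_inter_iff (hr : r.atoms ⊆ A) :
    r.Proves (I ∩ A) (σ.filter (· ∈ A)) c ↔ r.Proves I σ c := by
  have hhead := r.head_subset_atoms.trans hr
  have hpos := r.posBody_subset_atoms.trans hr
  have hneg := r.negBody_subset_atoms.trans hr
  refine and_congr_right fun hc => ?_
  have hsub : r.posBody ⊆ I ∩ A ↔ r.posBody ⊆ I := by grind
  have hinter : I ∩ A ∩ r.negBody = I ∩ r.negBody := by grind
  have hothers : I ∩ A ∩ (r.head \ {c}) = I ∩ (r.head \ {c}) := by grind
  rw [hsub, hinter, hothers]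
  refine and_congr_right fun _ => and_congr_right fun _ => and_congr_right fun _ =>
    forall₂_congr fun b hb => ?_
  exact pair_sublist_filter_iff (decide_eq_true (hpos hb)) (decide_eq_true (hhead hc))

theorem isModel_inter_iff (hA : ∀ r ∈ prog, r.atoms ⊆ A) :
    IsModel prog (I ∩ A) ↔ IsModel prog I :=
  forall₂_congr fun r hr => Rule.sat_inter_iff (hA r hr)

theorem isModel_union {prog₁ prog₂ : Program α} :
    IsModel (prog₁ ∪ prog₂) I ↔ IsModel prog₁ I ∧ IsModel prog₂ I :=
  Finset.forall_mem_union

theorem gatherProof_inter (hA : ∀ r ∈ prog, r.atoms ⊆ A) :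
    gatherProof (I ∩ A) (σ.filter (· ∈ A)) prog = gatherProof I σ prog := by
  ext c
  simp only [mem_gatherProof]
  exact exists_congr fun r => and_congr_right fun hr => Rule.proves_inter_iff (hA r hr)

theorem gatherProof_subset (hA : ∀ r ∈ prog, r.atoms ⊆ A) : gatherProof I σ prog ⊆ A := by
  intro c hc
  obtain ⟨r, hr, hc⟩ := mem_gatherProof.1 hc
  exact hA r hr (r.head_subset_atoms hc.1)

theorem gatherProof_union {prog₁ prog₂ : Program α} :
    gatherProof I σ (prog₁ ∪ prog₂) = gatherProof I σ prog₁ ∪ gatherProof I σ prog₂ :=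
  Finset.union_biUnion

theorem mem_bagProgram {b : Finset α} : r ∈ bagProgram prog b ↔ r ∈ prog ∧ r.atoms ⊆ b :=
  Finset.mem_filter

theorem atoms_subset_of_mem_bagProgram {b : Finset α} (hr : r ∈ bagProgram prog b) :
    r.atoms ⊆ b :=
  (mem_bagProgram.1 hr).2

theorem bagProgram_mono {b b' : Finset α} (h : b ⊆ b') : bagProgram prog b ⊆ bagProgram prog b' :=
  fun _ hr => mem_bagProgram.2 ⟨(mem_bagProgram.1 hr).1, (mem_bagProgram.1 hr).2.trans h⟩

end Locality

section ProgramBelow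

variable {α ι : Type*} [DecidableEq α] {prog : Program α} {T c : TTree α ι} {r : Rule α}

/-- The rules whose atoms lie in a common bag of the tree. For a subtree of a tree decomposition,
this is the part of the program that the bag-programs of the subtree have access to. -/
def programBelow (prog : Program α) : TTree α ι → Program α
  | .leaf b _ => bagProgram prog b
  | .unary b _ c => bagProgram prog b ∪ programBelow prog c
  | .binary b _ l r => bagProgram prog b ∪ (programBelow prog l ∪ programBelow prog r)

theorem bagProgram_subset_programBelow (prog : Program α) (T : TTree α ι) :
    bagProgram prog T.bag ⊆ programBelow prog T := by
  cases T with
  | leaf => exact Finset.Subset.refl _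
  | unary | binary => exact Finset.subset_union_left

theorem mem_programBelow :
    r ∈ programBelow prog T ↔ r ∈ prog ∧ ∃ B ∈ T.bags, r.atoms ⊆ B := by
  induction T using TTree.children_induction with
  | step T ih =>
    simp only [TTree.mem_bags_iff (T := T)]
    cases T <;> simp [programBelow, mem_bagProgram] at ih ⊢ <;> grind

theorem atoms_subset_of_mem_programBelow (hr : r ∈ programBelow prog T) : r.atoms ⊆ T.cover := by
  obtain ⟨-, B, hB, hrB⟩ := mem_programBelow.1 hr
  exact fun v hv => TTree.mem_cover.2 ⟨B, hB, hrB hv⟩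

end ProgramBelow

section PartialSolutions

variable {α ι : Type*} [DecidableEq α] {prog : Program α} {T c : TTree α ι} {I : Finset α}
  {σ : List α}

/-- The row that stores, at the root of `T`, an interpretation `I` with the atoms in the order
`σ`. Both are restricted to the bag and may contain atoms that do not occur in `T`. -/
def rowOf (prog : Program α) (T : TTree α ι) (I : Finset α) (σ : List α) : Row α :=
  ⟨I ∩ T.bag, gatherProof I σ (programBelow prog T) ∩ T.bag, σ.filter (· ∈ T.bag)⟩

/-- Along `σ`, the interpretation `I` is a partial solution below the root of `T`: it satisfies the
rules below, and those of its atoms that have been removed have been proven. The tree without atoms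
imposes no condition, because the algorithm does not check the bag-programs of the leaves. -/
structure IsPartialSolution (prog : Program α) (T : TTree α ι) (I : Finset α) (σ : List α) :
    Prop where
  isModel : T.cover.Nonempty → IsModel (programBelow prog T) I
  removed_subset : (I ∩ T.cover) \ T.bag ⊆ gatherProof I σ (programBelow prog T)

theorem gatherProof_programBelow_inter (prog : Program α) (T : TTree α ι) (I : Finset α)
    (σ : List α) : gatherProof (I ∩ T.cover) (σ.filter (· ∈ T.cover)) (programBelow prog T) =
      gatherProof I σ (programBelow prog T) :=
  gatherProof_inter fun _ => atoms_subset_of_mem_programBelow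

theorem rowOf_inter_cover (prog : Program α) (T : TTree α ι) (I : Finset α) (σ : List α) :
    rowOf prog T (I ∩ T.cover) (σ.filter (· ∈ T.cover)) = rowOf prog T I σ := by
  have hbag := T.bag_subset_cover
  rw [rowOf, gatherProof_programBelow_inter, Finset.inter_assoc, Finset.inter_eq_right.2 hbag,
    List.filter_filter, rowOf]
  congr 1
  grind

theorem isPartialSolution_inter_cover :
    IsPartialSolution prog T (I ∩ T.cover) (σ.filter (· ∈ T.cover)) ↔
      IsPartialSolution prog T I σ := by
  have hmodel : IsModel (programBelow prog T) (I ∩ T.cover) ↔ IsModel (programBelow prog T) I :=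
    isModel_inter_iff fun _ => atoms_subset_of_mem_programBelow
  have hinter : I ∩ T.cover ∩ T.cover = I ∩ T.cover := by grind
  constructor <;> rintro ⟨hsat, hremoved⟩ <;> constructor
  · simpa only [hmodel] using hsat
  · simpa only [hinter, gatherProof_programBelow_inter] using hremoved
  · simpa only [hmodel] using hsat
  · simpa only [hinter, gatherProof_programBelow_inter] using hremoved

theorem IsPartialSolution.child (hT : T.NiceTree) (h : IsPartialSolution prog T I σ)
    (hc : c ∈ T.children) : IsPartialSolution prog c I σ where
  isModel hne r hr := by
    obtain ⟨hr, B, hB, hrB⟩ := mem_programBelow.1 hr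
    exact h.isModel (hne.mono (TTree.cover_subset_of_mem_children hc)) r
      (mem_programBelow.2 ⟨hr, B, TTree.mem_bags_iff.2 (.inr ⟨c, hc, hB⟩), hrB⟩)
  removed_subset v hv := by
    simp only [Finset.mem_sdiff, Finset.mem_inter] at hv
    obtain ⟨⟨hvI, hvc⟩, hvb⟩ := hv
    have hvT : v ∉ T.bag := fun hvT =>
      hvb (hT.bag_inter_cover_subset hc (Finset.mem_inter.2 ⟨hvT, hvc⟩))
    have hvproven := h.removed_subset (Finset.mem_sdiff.2
      ⟨Finset.mem_inter.2 ⟨hvI, TTree.cover_subset_of_mem_children hc hvc⟩, hvT⟩)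
    obtain ⟨r, hr, hrv⟩ := mem_gatherProof.1 hvproven
    obtain ⟨hr, B, hB, hrB⟩ := mem_programBelow.1 hr
    have hBc := hT.mem_bags_child hc hB (hrB (r.head_subset_atoms hrv.1)) hvc hvT
    exact mem_gatherProof.2 ⟨r, mem_programBelow.2 ⟨hr, B, hBc, hrB⟩, hrv⟩

/-- The row `u` of the root of `T` arises from the interpretation `I` of atoms of `T`. -/
def Realizes (prog : Program α) (T : TTree α ι) (u : Row α) (I : Finset α) : Prop :=
  I ⊆ T.cover ∧ ∃ σ : List α, σ.Nodup ∧ (∀ v, v ∈ σ ↔ v ∈ I) ∧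
    IsPartialSolution prog T I σ ∧ rowOf prog T I σ = u

theorem Realizes.interp_eq {u : Row α} (h : Realizes prog T u I) : u.interp = I ∩ T.bag := by
  obtain ⟨-, σ, -, -, -, rfl⟩ := h
  rfl

theorem realizes_rowOf_child (hσ : σ.Nodup) (hmem : ∀ v, v ∈ σ ↔ v ∈ I)
    (h : IsPartialSolution prog T I σ) (hT : T.NiceTree) (hc : c ∈ T.children) :
    Realizes prog c (rowOf prog c I σ) (I ∩ c.cover) :=
  ⟨Finset.inter_subset_right, σ.filter (· ∈ c.cover), hσ.filter _, by simp [hmem],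
    isPartialSolution_inter_cover.2 (h.child hT hc), rowOf_inter_cover prog c I σ⟩

end PartialSolutions

/-! ### The table algorithm PHC at a node -/

section Nodes

variable {α ι : Type*} [DecidableEq α] {prog : Program α} {a : α} {b : Finset α} {x : ι}
  {c l r : TTree α ι} {s s₁ s₂ u : Row α} {I I' I₁ I₂ : Finset α} {σ : List α}

theorem mem_phc_introduce {τ : Table α} (ha : a ∉ c.bag) :
    u ∈ phc prog (.unary (insert a c.bag) x c) [τ] ↔
      ∃ s ∈ τ, ∃ J, (J = s.interp ∨ J = insert a s.interp) ∧
        IsModel (bagProgram prog (insert a c.bag)) J ∧ ∃ σ ∈ possOrd s.order ({a} ∩ J),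
          ⟨J, s.proven ∪ gatherProof J σ (bagProgram prog (insert a c.bag)), σ⟩ = u := by
  have hint : TTree.IsInt (insert a c.bag) c.bag :=
    ⟨Finset.subset_insert a _, Finset.card_insert_of_notMem ha⟩
  simp only [phc, if_pos hint, Finset.insert_sdiff_cancel ha, Finset.singleton_biUnion, phcInt,
    Finset.mem_biUnion, Finset.mem_filter, Finset.mem_insert, Finset.mem_singleton,
    Finset.mem_image, and_assoc]

theorem mem_phc_removal {τ : Table α} (ha : a ∈ c.bag) :
    u ∈ phc prog (.unary (c.bag.erase a) x c) [τ] ↔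
      ∃ s ∈ τ, (a ∈ s.proven ∨ a ∉ s.interp) ∧
        ⟨s.interp.erase a, s.proven.erase a, s.order.erase a⟩ = u := by
  have hcard := Finset.card_erase_add_one ha
  have hint : ¬ TTree.IsInt (c.bag.erase a) c.bag := fun h => by omega
  have hrem : TTree.IsRem (c.bag.erase a) c.bag := ⟨Finset.erase_subset _ _, hcard.symm⟩
  simp only [phc, if_neg hint, if_pos hrem, Finset.sdiff_erase_self ha, Finset.singleton_biUnion,
    phcRem, Finset.mem_image, Finset.mem_filter, Finset.mem_union, Finset.mem_sdiff,
    Finset.mem_singleton, true_and, and_assoc]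

theorem mem_phc_join {τ₁ τ₂ : Table α} (hl : l.bag = b) (hr : r.bag = b) (hb : b ≠ ∅) :
    u ∈ phc prog (.binary b x l r) [τ₁, τ₂] ↔
      ∃ s₁ ∈ τ₁, ∃ s₂ ∈ τ₂, s₁.interp = s₂.interp ∧ s₁.order = s₂.order ∧
        ⟨s₁.interp, s₁.proven ∪ s₂.proven, s₁.order⟩ = u := by
  have hjoin : TTree.IsJoin b l.bag r.bag := ⟨hl.symm, hr.symm, hb⟩
  simp only [phc, if_pos hjoin, phcJoin, Finset.mem_image, Finset.mem_filter, Finset.mem_product,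
    Prod.exists, and_assoc]
  grind

theorem programBelow_removal :
    programBelow prog (.unary (c.bag.erase a) x c) = programBelow prog c :=
  Finset.union_eq_right.2
    ((bagProgram_mono (Finset.erase_subset a _)).trans (bagProgram_subset_programBelow prog c))

theorem programBelow_join (hl : l.bag = b) :
    programBelow prog (.binary b x l r) = programBelow prog l ∪ programBelow prog r :=
  Finset.union_eq_right.2
    ((hl ▸ bagProgram_subset_programBelow prog l).trans Finset.subset_union_left)

theorem cover_removal : (TTree.unary (c.bag.erase a) x c).cover = c.cover :=
  Finset.union_eq_right.2 ((Finset.erase_subset a _).trans c.bag_subset_cover)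

theorem rowOf_introduce (ha : a ∉ c.cover) :
    rowOf prog (.unary (insert a c.bag) x c) I σ =
      ⟨I ∩ insert a c.bag, (rowOf prog c I σ).proven ∪
        gatherProof (I ∩ insert a c.bag) (σ.filter (· ∈ insert a c.bag))
          (bagProgram prog (insert a c.bag)), σ.filter (· ∈ insert a c.bag)⟩ := by
  have hbag : gatherProof I σ (bagProgram prog (insert a c.bag)) ⊆ insert a c.bag :=
    gatherProof_subset fun _ => atoms_subset_of_mem_bagProgram
  have hbelow : gatherProof I σ (programBelow prog c) ⊆ c.cover :=
    gatherProof_subset fun _ => atoms_subset_of_mem_programBelow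
  rw [gatherProof_inter fun _ => atoms_subset_of_mem_bagProgram]
  simp only [rowOf, programBelow, gatherProof_union, TTree.bag_unary]
  congr 1
  grind

theorem rowOf_removal (hσ : σ.Nodup) :
    rowOf prog (.unary (c.bag.erase a) x c) I σ =
      ⟨(rowOf prog c I σ).interp.erase a, (rowOf prog c I σ).proven.erase a,
        (rowOf prog c I σ).order.erase a⟩ := by
  simp only [rowOf, programBelow_removal, TTree.bag_unary, filter_erase_of_nodup hσ,
    Finset.inter_erase]
  rfl

theorem rowOf_join (hl : l.bag = b) (hr : r.bag = b) :
    rowOf prog (.binary b x l r) I σ =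
      ⟨(rowOf prog l I σ).interp, (rowOf prog l I σ).proven ∪ (rowOf prog r I σ).proven,
        (rowOf prog l I σ).order⟩ := by
  simp only [rowOf, programBelow_join hl, TTree.bag_binary, gatherProof_union, hl, hr,
    Finset.union_inter_distrib_right]
  rfl

end Nodes

section Decomposition

variable {α ι : Type*} [DecidableEq α] {prog : Program α} {T : TTree α ι} {I : Finset α}
  {σ : List α}

theorem IsPartialSolution.rowOf_mem_phc (hT : T.NiceTree) (h : IsPartialSolution prog T I σ)
    (hσ : σ.Nodup) (hmem : ∀ v, v ∈ σ ↔ v ∈ I) :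
    rowOf prog T I σ ∈ phc prog T (T.children.map fun c => {rowOf prog c I σ}) := by
  cases hT with
  | leaf x => simp [rowOf, phc, Row.empty]
  | introduce a x c ha hc =>
    have hac : a ∉ c.bag := fun h => ha (c.bag_subset_cover h)
    rw [rowOf_introduce ha]
    refine (mem_phc_introduce hac).2 ⟨_, Finset.mem_singleton_self _, _, ?_, ?_, _, ?_, rfl⟩
    · simp only [rowOf]
      grind
    · have hmodel := h.isModel ⟨a, TTree.bag_subset_cover _ (Finset.mem_insert_self a _)⟩
      exact (isModel_inter_iff fun _ => atoms_subset_of_mem_bagProgram).2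
        (isModel_union.1 hmodel).1
    · exact filter_insert_mem_possOrd hσ hac (by simp [hmem])
  | removal a x c ha hc =>
    rw [rowOf_removal hσ]
    refine (mem_phc_removal ha).2 ⟨_, Finset.mem_singleton_self _, ?_, rfl⟩
    by_cases haI : a ∈ I
    · have hremoved := h.removed_subset
      rw [cover_removal, programBelow_removal] at hremoved
      exact .inl (Finset.mem_inter.2 ⟨hremoved (Finset.mem_sdiff.2
        ⟨Finset.mem_inter.2 ⟨haI, c.bag_subset_cover ha⟩, Finset.notMem_erase a _⟩), ha⟩)
    · exact .inr fun h => haI (Finset.mem_inter.1 h).1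
  | join b x l r hl hr hb hlr hln hrn =>
    rw [rowOf_join hl hr]
    refine (mem_phc_join hl hr hb).2 ⟨_, Finset.mem_singleton_self _, _,
      Finset.mem_singleton_self _, ?_, ?_, rfl⟩
    all_goals simp only [rowOf, hl, hr]

end Decomposition

section Glueing

variable {α ι : Type*} [DecidableEq α] {prog : Program α} {a : α} {b : Finset α} {x : ι}
  {T c l r : TTree α ι} {s s₁ s₂ u : Row α} {I I' I₁ I₂ : Finset α} {σ σ' : List α}

theorem isPartialSolution_of_restrict (h : IsPartialSolution prog c I' σ')
    (hI : I ∩ c.cover = I') (hσ : σ.filter (· ∈ c.cover) = σ') :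
    IsPartialSolution prog c I σ ∧ rowOf prog c I σ = rowOf prog c I' σ' := by
  subst hI hσ
  exact ⟨isPartialSolution_inter_cover.1 h, (rowOf_inter_cover prog c I σ).symm⟩

theorem IsPartialSolution.introduce (h : IsPartialSolution prog c I σ)
    (hmodel : IsModel (bagProgram prog (insert a c.bag)) I) :
    IsPartialSolution prog (.unary (insert a c.bag) x c) I σ where
  isModel _ := isModel_union.2 ⟨hmodel, by
    rcases c.cover.eq_empty_or_nonempty with hempty | hne
    · exact fun r hr => hmodel r (mem_bagProgram.2 ⟨(mem_programBelow.1 hr).1,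
        (atoms_subset_of_mem_programBelow hr).trans (hempty ▸ Finset.empty_subset _)⟩)
    · exact h.isModel hne⟩
  removed_subset := by
    have hremoved := h.removed_subset
    simp only [programBelow, gatherProof_union, TTree.cover, TTree.bag_unary]
    grind

theorem IsPartialSolution.removal (ha : a ∈ c.bag) (h : IsPartialSolution prog c I σ)
    (hproven : a ∈ (rowOf prog c I σ).proven ∨ a ∉ (rowOf prog c I σ).interp) :
    IsPartialSolution prog (.unary (c.bag.erase a) x c) I σ where
  isModel hne := by
    rw [cover_removal] at hne
    rw [programBelow_removal]
    exact h.isModel hne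
  removed_subset := by
    have hremoved := h.removed_subset
    rw [programBelow_removal, cover_removal]
    simp only [rowOf, TTree.bag_unary] at hproven ⊢
    grind

theorem IsPartialSolution.join (hbl : l.bag = b) (hbr : r.bag = b) (hb : b ≠ ∅)
    (hl : IsPartialSolution prog l I σ) (hr : IsPartialSolution prog r I σ) :
    IsPartialSolution prog (.binary b x l r) I σ where
  isModel _ := by
    have hb := Finset.nonempty_iff_ne_empty.2 hb
    rw [programBelow_join hbl]
    exact isModel_union.2 ⟨hl.isModel ((hbl ▸ hb).mono l.bag_subset_cover),
      hr.isModel ((hbr ▸ hb).mono r.bag_subset_cover)⟩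
  removed_subset := by
    have hremovedl := hl.removed_subset
    have hremovedr := hr.removed_subset
    rw [programBelow_join hbl, gatherProof_union]
    simp only [TTree.cover, TTree.bag_binary]
    grind

theorem Realizes.introduce (ha : a ∉ c.cover)
    (hu : u ∈ phc prog (.unary (insert a c.bag) x c) [{s}]) (hs : Realizes prog c s I') :
    ∃ I, Realizes prog (.unary (insert a c.bag) x c) u I ∧ I ∩ c.cover = I' := by
  obtain ⟨hI', σ', hσ', hmem', hpartial, rfl⟩ := hs
  have hac : a ∉ c.bag := fun h => ha (c.bag_subset_cover h)
  have haσ' : a ∉ σ' := fun h => ha (hI' ((hmem' a).1 h))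
  obtain ⟨_, hs, J, hJ, hmodel, ρ, hρ, rfl⟩ := (mem_phc_introduce hac).1 hu
  obtain rfl := Finset.mem_singleton.1 hs
  obtain ⟨σ, hσ, rfl, rfl, haJ⟩ := exists_filter_insert_eq hσ' haσ' hρ
  have herase : σ.toFinset.erase a = I' := by
    ext v
    simpa [and_comm] using hmem' v
  rw [← List.mem_toFinset] at haJ
  have hcover : σ.toFinset ∩ c.cover = I' := by
    clear * - ha hI' herase
    grind
  have hbag : σ.toFinset ∩ insert a c.bag = J := by
    change J = I' ∩ c.bag ∨ J = insert a (I' ∩ c.bag) at hJ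
    clear * - hac hJ herase haJ
    grind
  have hrestrict : σ.filter (· ∈ c.cover) = σ.filter (· ≠ a) := by
    refine List.filter_congr fun v hv => ?_
    by_cases hva : v = a
    · simp [hva, ha]
    · simp [hva, hI' ((hmem' v).1 (List.mem_filter.2 ⟨hv, by simpa⟩))]
  obtain ⟨hpartial, hrow⟩ := isPartialSolution_of_restrict hpartial hcover hrestrict
  rw [← hbag, isModel_inter_iff fun _ => atoms_subset_of_mem_bagProgram] at hmodel
  refine ⟨σ.toFinset, ⟨?_, σ, hσ, fun _ => List.mem_toFinset.symm,
    hpartial.introduce hmodel, ?_⟩, hcover⟩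
  · simp only [TTree.cover]
    grind
  · rw [rowOf_introduce ha, hbag, hrow]

theorem Realizes.removal (ha : a ∈ c.bag)
    (hu : u ∈ phc prog (.unary (c.bag.erase a) x c) [{s}]) (hs : Realizes prog c s I) :
    Realizes prog (.unary (c.bag.erase a) x c) u I := by
  obtain ⟨hI, σ, hσ, hmem, hpartial, rfl⟩ := hs
  obtain ⟨_, hs, hproven, rfl⟩ := (mem_phc_removal ha).1 hu
  obtain rfl := Finset.mem_singleton.1 hs
  refine ⟨?_, σ, hσ, hmem, hpartial.removal ha hproven, rowOf_removal hσ⟩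
  rwa [cover_removal]

theorem Realizes.join (hbl : l.bag = b) (hbr : r.bag = b) (hb : b ≠ ∅)
    (hlr : l.cover ∩ r.cover ⊆ b) (hu : u ∈ phc prog (.binary b x l r) [{s₁}, {s₂}])
    (hl : Realizes prog l s₁ I₁) (hr : Realizes prog r s₂ I₂) :
    ∃ I, Realizes prog (.binary b x l r) u I ∧ I ∩ l.cover = I₁ ∧ I ∩ r.cover = I₂ := by
  obtain ⟨hI₁, σ₁, hσ₁, hmem₁, hpartial₁, rfl⟩ := hl
  obtain ⟨hI₂, σ₂, hσ₂, hmem₂, hpartial₂, rfl⟩ := hr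
  obtain ⟨_, hs₁, _, hs₂, hinterp, horder, rfl⟩ := (mem_phc_join hbl hbr hb).1 hu
  obtain rfl := Finset.mem_singleton.1 hs₁
  obtain rfl := Finset.mem_singleton.1 hs₂
  have hbagl := hbl ▸ l.bag_subset_cover
  have hbagr := hbr ▸ r.bag_subset_cover
  simp only [rowOf, hbl, hbr] at hinterp horder
  have hoverlap : σ₁.filter (· ∈ r.cover) = σ₂.filter (· ∈ l.cover) := by
    rw [List.filter_congr (q := (· ∈ b)) (by grind), horder]
    exact List.filter_congr (by grind)
  obtain ⟨σ, rfl, rfl, hσcover⟩ := exists_filter_eq_of_filter_eq (p := (· ∈ l.cover))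
    (q := (· ∈ r.cover)) (by grind) (by grind) hoverlap
  have hcoverl : σ.toFinset ∩ l.cover = I₁ := by
    ext v
    simpa using hmem₁ v
  have hcoverr : σ.toFinset ∩ r.cover = I₂ := by
    ext v
    simpa using hmem₂ v
  obtain ⟨hpartial₁, hrow₁⟩ := isPartialSolution_of_restrict hpartial₁ hcoverl rfl
  obtain ⟨hpartial₂, hrow₂⟩ := isPartialSolution_of_restrict hpartial₂ hcoverr rfl
  refine ⟨σ.toFinset, ⟨?_, σ, nodup_of_nodup_filter hσ₁ hσ₂ hσcover,
    fun _ => List.mem_toFinset.symm, hpartial₁.join hbl hbr hb hpartial₂, ?_⟩, hcoverl, hcoverr⟩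
  · intro v hv
    have hvlr := hσcover v (List.mem_toFinset.1 hv)
    simp only [TTree.cover, Finset.mem_union]
    grind
  · rw [rowOf_join hbl hbr, hrow₁, hrow₂]

end Glueing

/-! ### The tables and the answer sets -/

section DynamicProgramming

namespace TTree

variable {α ι ο : Type*} (A : TTree α ι → List ο → ο) (T : TTree α ι)

theorem bag_dp : (dp A T).bag = T.bag := by
  cases T <;> rfl

theorem tab_dp : (dp A T).tab = A T (T.children.map fun c => (dp A c).tab) := by
  cases T <;> rfl

theorem children_dp : (dp A T).children = T.children.map (dp A) := by
  cases T <;> rfl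

end TTree

end DynamicProgramming

section Tables

variable {α ι κ : Type*} [DecidableEq α] {prog : Program α} {T : TTree α ι} {S : TTree α κ}
  {u : Row α} {τs : List (Table α)} {o : List (Row α)} {I : Finset α}

theorem phc_congr (hbag : T.bag = S.bag)
    (hchildren : T.children.map TTree.bag = S.children.map TTree.bag) :
    phc prog T = phc prog S := by
  cases T <;> cases S <;>
    simp only [TTree.bag_leaf, TTree.bag_unary, TTree.bag_binary, TTree.children_leaf,
      TTree.children_unary, TTree.children_binary, List.map_cons, List.map_nil, List.cons.injEq,
      reduceCtorEq, and_true, and_false] at hbag hchildren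
  · funext τs
    cases τs <;> rfl
  · funext τs
    rcases τs with - | ⟨τ, - | -⟩ <;> simp only [phc, hbag, hchildren]
  · funext τs
    rcases τs with - | ⟨τ₁, - | ⟨τ₂, - | -⟩⟩ <;> simp only [phc, hbag, hchildren]

theorem length_eq_of_mem_phc (h : u ∈ phc prog T τs) : τs.length = T.children.length := by
  unfold phc at h
  split at h <;> simp at h ⊢

theorem mem_rowSeqs : o ∈ rowSeqs τs ↔ List.Forall₂ (· ∈ ·) o τs := by
  induction τs generalizing o with
  | nil => simp [rowSeqs]
  | cons τ τs ih => simp [rowSeqs, List.forall₂_cons_right_iff, ih, and_assoc, eq_comm]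

theorem mem_of_mem_rowSeqs {i : ℕ} {s : Row α} {τ : Table α} (ho : o ∈ rowSeqs τs)
    (hs : o[i]? = some s) (hτ : τs[i]? = some τ) : s ∈ τ := by
  obtain ⟨hi, rfl⟩ := List.getElem?_eq_some_iff.1 hs
  obtain ⟨hi', rfl⟩ := List.getElem?_eq_some_iff.1 hτ
  exact (List.forall₂_iff_get.1 (mem_rowSeqs.1 ho)).2 i hi hi'

theorem mem_rowSeqs_of_getElem?
    (hlen : o.length = τs.length)
    (h : ∀ (i : ℕ) s τ, o[i]? = some s → τs[i]? = some τ → s ∈ τ) : o ∈ rowSeqs τs :=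
  mem_rowSeqs.2 <| List.forall₂_iff_get.2 ⟨hlen, fun i hi hi' =>
    h i _ _ (List.getElem?_eq_getElem hi) (List.getElem?_eq_getElem hi')⟩

theorem mem_phc_unary_iff {b : Finset α} {x : ι} {c : TTree α ι} {τ : Table α} :
    u ∈ phc prog (.unary b x c) [τ] ↔ ∃ s ∈ τ, u ∈ phc prog (.unary b x c) [{s}] := by
  simp only [phc, phcInt, phcRem]
  split_ifs
  · simp only [Finset.mem_biUnion, Finset.mem_sdiff, Finset.mem_filter, Finset.mem_insert,
      Finset.mem_singleton, Finset.mem_image, Finset.singleton_biUnion]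
    grind
  · simp only [Finset.mem_union, Finset.mem_sdiff, Finset.mem_singleton, true_and,
      Finset.mem_biUnion, Finset.mem_image, Finset.mem_filter, ↓existsAndEq]
    grind
  · simp

theorem mem_phc_binary_iff {b : Finset α} {x : ι} {l r : TTree α ι} {τ₁ τ₂ : Table α} :
    u ∈ phc prog (.binary b x l r) [τ₁, τ₂] ↔
      ∃ s₁ ∈ τ₁, ∃ s₂ ∈ τ₂, u ∈ phc prog (.binary b x l r) [{s₁}, {s₂}] := by
  simp only [phc, phcJoin]
  split_ifs
  · simp only [Finset.mem_image, Finset.mem_filter, Finset.mem_product, Prod.exists,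
      Finset.mem_singleton]
    grind
  · simp

theorem mem_phc_iff_exists_rowSeq (hτs : τs.length = T.children.length) :
    u ∈ phc prog T τs ↔ ∃ o ∈ rowSeqs τs, u ∈ phc prog T (o.map fun v => {v}) := by
  cases T with
  | leaf =>
    obtain rfl := List.length_eq_zero_iff.1 hτs
    simp [rowSeqs]
  | unary =>
    obtain ⟨τ, rfl⟩ := List.length_eq_one_iff.1 hτs
    rw [mem_phc_unary_iff]
    simp [rowSeqs]
  | binary =>
    obtain ⟨τ₁, τ₂, rfl⟩ := List.length_eq_two.1 hτs
    rw [mem_phc_binary_iff]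
    simp only [rowSeqs, Finset.mem_image, Finset.mem_product, Prod.exists, Finset.mem_singleton]
    grind

theorem TTree.NiceTree.exists_realizes_of_mem_phc (hT : T.NiceTree)
    (hu : u ∈ phc prog T (o.map fun v => {v})) {J : Fin T.children.length → Finset α}
    (hJ : ∀ (i : Fin T.children.length) s, o[(i : ℕ)]? = some s →
      Realizes prog T.children[i] s (J i)) :
    ∃ I, Realizes prog T u I ∧ ∀ i : Fin T.children.length, I ∩ T.children[i].cover = J i := by
  cases hT with
  | leaf x =>
    obtain rfl : o = [] := by simpa using length_eq_of_mem_phc hu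
    obtain rfl := Finset.mem_singleton.1 hu
    refine ⟨∅, ⟨Finset.empty_subset _, [], List.nodup_nil, by simp, ⟨?_, by simp⟩, ?_⟩,
      fun i => i.elim0⟩
    · simp [TTree.cover]
    · simp [rowOf, Row.empty]
  | introduce a x c ha hc =>
    obtain ⟨s, rfl⟩ : ∃ s, o = [s] :=
      List.length_eq_one_iff.1 (by simpa using length_eq_of_mem_phc hu)
    obtain ⟨I, hI, hIc⟩ := Realizes.introduce ha hu (hJ ⟨0, zero_lt_one⟩ s rfl)
    exact ⟨I, hI, Fin.forall_fin_one.2 hIc⟩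
  | removal a x c ha hc =>
    obtain ⟨s, rfl⟩ : ∃ s, o = [s] :=
      List.length_eq_one_iff.1 (by simpa using length_eq_of_mem_phc hu)
    have hs := hJ ⟨0, zero_lt_one⟩ s rfl
    exact ⟨J ⟨0, zero_lt_one⟩, hs.removal ha hu,
      Fin.forall_fin_one.2 (Finset.inter_eq_left.2 hs.1)⟩
  | join b x l r hbl hbr hb hlr hl hr =>
    obtain ⟨s₁, s₂, rfl⟩ : ∃ s₁ s₂, o = [s₁, s₂] :=
      List.length_eq_two.1 (by simpa using length_eq_of_mem_phc hu)
    obtain ⟨I, hI, hIl, hIr⟩ := Realizes.join hbl hbr hb hlr hu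
      (hJ ⟨0, zero_lt_two⟩ s₁ rfl) (hJ ⟨1, one_lt_two⟩ s₂ rfl)
    exact ⟨I, hI, Fin.forall_fin_two.2 ⟨hIl, hIr⟩⟩

theorem mem_dpPHC_tab (hT : T.NiceTree) :
    u ∈ (dpPHC prog T).tab ↔ ∃ I, Realizes prog T u I := by
  induction T using TTree.children_induction generalizing u with
  | step T ih =>
    rw [dpPHC, TTree.tab_dp, mem_phc_iff_exists_rowSeq (List.length_map _)]
    constructor
    · rintro ⟨o, ho, hu⟩
      have hchild : ∀ i : Fin T.children.length, ∃ I',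
          ∀ s, o[(i : ℕ)]? = some s → Realizes prog T.children[i] s I' := fun i => by
        by_cases hs : ∃ s, o[(i : ℕ)]? = some s
        · obtain ⟨s, hs⟩ := hs
          have htab : s ∈ (dpPHC prog T.children[i]).tab := mem_of_mem_rowSeqs ho hs (by simp; rfl)
          obtain ⟨I', hI'⟩ := (ih _ (List.getElem_mem _) (hT.child (List.getElem_mem _))).1 htab
          refine ⟨I', fun s' hs' => ?_⟩
          rwa [← Option.some.inj (hs.symm.trans hs')]
        · exact ⟨∅, fun s h => (hs ⟨s, h⟩).elim⟩
      choose J hJ using hchild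
      obtain ⟨I, hI, -⟩ := hT.exists_realizes_of_mem_phc hu hJ
      exact ⟨I, hI⟩
    · rintro ⟨I, -, σ, hσ, hmem, hpartial, rfl⟩
      refine ⟨T.children.map fun c => rowOf prog c I σ, ?_, ?_⟩
      · refine mem_rowSeqs.2 ?_
        rw [List.forall₂_map_left_iff, List.forall₂_map_right_iff, List.forall₂_same]
        exact fun c hc => (ih c hc (hT.child hc)).2
          ⟨_, realizes_rowOf_child hσ hmem hpartial hT hc⟩
      · rw [List.map_map]
        exact hpartial.rowOf_mem_phc hT hσ hmem

end Tables

section Root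

variable {α ι : Type*} [DecidableEq α] {prog : Program α} {T : TTree α ι} {u : Row α} {r : Rule α}
  {I : Finset α} {σ : List α}

theorem Rule.eq_empty_of_atoms_eq_empty (h : r.atoms = ∅) : r = Rule.empty α := by
  obtain ⟨head, posBody, negBody, _, _, _⟩ := r
  simp only [Rule.atoms, Finset.union_eq_empty] at h
  obtain ⟨⟨rfl, rfl⟩, rfl⟩ := h
  rfl

theorem atoms_nonempty (hr : r ∈ prog) (hne : prog ≠ {Rule.empty α}) :
    (atoms prog).Nonempty := by
  rw [atoms, Finset.biUnion_nonempty]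
  by_contra! hempty
  exact hne (Finset.eq_singleton_iff_nonempty_unique_mem.2
    ⟨⟨r, hr⟩, fun q hq => Rule.eq_empty_of_atoms_eq_empty (hempty q hq)⟩)

theorem IsNiceTD.programBelow_eq (hT : IsNiceTD prog T) : programBelow prog T = prog := by
  ext r
  rw [mem_programBelow, and_iff_left_iff_imp]
  exact hT.exists_bag_of_mem

theorem IsNiceTD.isPartialSolution_iff (hT : IsNiceTD prog T) (hne : prog ≠ {Rule.empty α}) :
    IsPartialSolution prog T I σ ↔
      IsModel prog I ∧ ∀ c ∈ I ∩ atoms prog, ∃ r ∈ prog, r.Proves I σ c := by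
  have hproven : (I ∩ T.cover) \ T.bag ⊆ gatherProof I σ (programBelow prog T) ↔
      ∀ c ∈ I ∩ atoms prog, ∃ r ∈ prog, r.Proves I σ c := by
    rw [hT.programBelow_eq, hT.cover_eq, hT.2.2, Finset.sdiff_empty]
    exact forall₂_congr fun c _ => mem_gatherProof
  constructor
  · rintro ⟨hmodel, hremoved⟩
    rw [hT.programBelow_eq, hT.cover_eq] at hmodel
    exact ⟨fun r hr => hmodel (atoms_nonempty hr hne) r hr, hproven.1 hremoved⟩
  · rintro ⟨hmodel, hproves⟩
    exact ⟨fun _ => hT.programBelow_eq.symm ▸ hmodel, hproven.2 hproves⟩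

theorem IsNiceTD.rowOf_eq_empty (hT : IsNiceTD prog T) : rowOf prog T I σ = Row.empty α := by
  simp [rowOf, hT.2.2, Row.empty]

theorem IsNiceTD.realizes_iff (hT : IsNiceTD prog T) (hcf : HeadCycleFree prog)
    (hne : prog ≠ {Rule.empty α}) :
    Realizes prog T u I ↔ u = Row.empty α ∧ IsAnswerSet prog I := by
  simp only [Realizes, hT.cover_eq, hT.isPartialSolution_iff hne, hT.rowOf_eq_empty,
    isAnswerSet_iff_exists_isProvenModel hcf]
  constructor
  · rintro ⟨hI, σ, hσ, hmem, ⟨hmodel, hproves⟩, rfl⟩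
    exact ⟨rfl, σ, hmodel, hσ, hmem, by rwa [Finset.inter_eq_left.2 hI] at hproves⟩
  · rintro ⟨rfl, σ, h⟩
    refine ⟨fun c hc => ?_, σ, h.nodup, h.mem_iff, ⟨h.isModel, fun c hc => ?_⟩, rfl⟩
    · obtain ⟨r, hr, hrc⟩ := h.proves c hc
      exact Finset.mem_biUnion.2 ⟨r, hr, r.head_subset_atoms hrc.1⟩
    · exact h.proves c (Finset.mem_inter.1 hc).1

end Root

/-! ### Inclusion-exclusion -/

section InclusionExclusion

variable {κ β : Type*} [DecidableEq β]

/-- The intersection of the sets `S i` for `i ∈ X`; it is empty if `X` is empty. -/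
def common (X : Finset κ) (S : κ → Finset β) : Finset β :=
  (X.biUnion S).filter fun q => ∀ i ∈ X, q ∈ S i

theorem mem_common {X : Finset κ} (hX : X.Nonempty) {S : κ → Finset β} {q : β} :
    q ∈ common X S ↔ ∀ i ∈ X, q ∈ S i := by
  obtain ⟨i, hi⟩ := hX
  simp only [common, Finset.mem_filter, Finset.mem_biUnion, and_iff_right_iff_imp]
  exact fun h => ⟨i, hi, h i hi⟩

theorem card_biUnion_eq_sum_common [DecidableEq κ] (X : Finset κ) (S : κ → Finset β) :
    ((X.biUnion S).card : ℤ) =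
      ∑ Y ∈ X.powerset.erase ∅, (-1) ^ (Y.card - 1) * ((common Y S).card : ℤ) := by
  have nonempty_subsets : X.powerset.filter (·.Nonempty) = X.powerset.erase ∅ := by
    ext Y
    simp [Finset.nonempty_iff_ne_empty, and_comm]
  rw [Finset.inclusion_exclusion_card_biUnion, ← nonempty_subsets,
    ← Finset.sum_coe_sort (X.powerset.filter (·.Nonempty)) fun Y =>
      (-1) ^ (Y.card - 1) * ((common Y S).card : ℤ)]
  refine Finset.sum_congr rfl fun Y _ => ?_
  have hY : Y.1.Nonempty := (Finset.mem_filter.1 Y.2).2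
  have inf'_eq_common : Y.1.inf' hY S = common Y.1 S := by
    ext q
    rw [mem_common hY, Finset.mem_inf']
  have card_succ : Y.1.card + 1 = (Y.1.card - 1) + 2 := by
    have := hY.card_pos
    omega
  rw [inf'_eq_common, card_succ, pow_add, neg_one_sq, mul_one]

end InclusionExclusion

section Projection

variable {α ι : Type*} [DecidableEq α] {prog : Program α} {P : Finset α}

theorem pmc_eq_card {t : TTree α (Table α)} {πs : List (ProjTable α)} {ρ : Table α}
    {F : List (Row α) → Finset (Finset α)}
    (hF : ∀ O ⊆ origs prog t ρ, O.Nonempty → sipmcSeq πs O = (common O F).card) :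
    pmc prog t πs ρ = (((origs prog t ρ).biUnion F).card : ℤ) := by
  rw [pmc, card_biUnion_eq_sum_common]
  refine Finset.sum_congr rfl fun O hO => ?_
  rw [Finset.mem_erase, Finset.mem_powerset] at hO
  rw [hF O hO.2 (Finset.nonempty_iff_ne_empty.2 hO.1)]

/-- In the inclusion-exclusion formula for `ρ.biUnion S`, all terms but that of `ρ` cancel. -/
theorem ipmc_eq_card {t : TTree α (Table α)} {πs : List (ProjTable α)}
    {S : Row α → Finset (Finset α)} (ht : t.children ≠ []) {ρ : Table α} (hρ : ρ.Nonempty)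
    (hS : ∀ φ ⊆ ρ, φ.Nonempty → pmc prog t πs φ = ((φ.biUnion S).card : ℤ)) :
    ipmc prog t πs ρ = (common ρ S).card := by
  induction ρ using Finset.strongInduction with
  | H ρ ih =>
    have cancel : ∑ φ ∈ ρ.ssubsets.erase ∅, ((-1) ^ (φ.card - 1) * ((common φ S).card : ℤ) +
        (-1) ^ φ.card * (ipmc prog t πs φ : ℤ)) = 0 := by
      refine Finset.sum_eq_zero fun φ hφ => ?_
      rw [Finset.mem_erase, Finset.mem_ssubsets] at hφ
      have hne := Finset.nonempty_iff_ne_empty.2 hφ.1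
      rw [ih φ hφ.2 hne fun ψ hψ => hS ψ (hψ.trans hφ.2.subset)]
      obtain ⟨k, hk⟩ := Nat.exists_eq_add_one.2 hne.card_pos
      rw [hk, Nat.add_sub_cancel, pow_succ]
      ring
    have self_mem : ρ ∈ ρ.powerset.erase ∅ :=
      Finset.mem_erase.2 ⟨hρ.ne_empty, Finset.mem_powerset_self ρ⟩
    have erase_self : (ρ.powerset.erase ∅).erase ρ = ρ.ssubsets.erase ∅ := by
      rw [Finset.ssubsets, Finset.erase_right_comm]
    rw [ipmc, if_neg (by simpa using ht), hS ρ subset_rfl hρ,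
      Finset.sum_attach _ fun φ => (-1) ^ φ.card * (ipmc prog t πs φ : ℤ),
      card_biUnion_eq_sum_common, ← Finset.add_sum_erase _ _ self_mem, erase_self, add_assoc,
      ← Finset.sum_add_distrib, cancel, add_zero, Int.natAbs_mul, Int.natAbs_pow]
    simp

theorem mem_subBuckets {ν ρ : Table α} :
    ρ ∈ subBuckets P ν ↔
      ρ.Nonempty ∧ ρ ⊆ ν ∧ ∀ u ∈ ρ, ∀ v ∈ ρ, u.interp ∩ P = v.interp ∩ P := by
  simp only [subBuckets, buckets, Finset.mem_biUnion, Finset.mem_image, Finset.mem_erase,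
    Finset.mem_powerset, exists_exists_and_eq_and, ← Finset.nonempty_iff_ne_empty]
  constructor
  · rintro ⟨w, -, hne, hsub⟩
    refine ⟨hne, hsub.trans (Finset.filter_subset _ _), fun u hu v hv => ?_⟩
    rw [(Finset.mem_filter.1 (hsub hu)).2, (Finset.mem_filter.1 (hsub hv)).2]
  · rintro ⟨⟨u, hu⟩, hsub, h⟩
    exact ⟨u, hsub hu, ⟨u, hu⟩, fun v hv => Finset.mem_filter.2 ⟨hsub hv, h v hv u hu⟩⟩

theorem sipmc_proj {t : TTree α (Table α)} {πs : List (ProjTable α)} {ρ : Table α} :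
    sipmc (proj prog P t πs) ρ = if ρ ∈ subBuckets P t.tab then ipmc prog t πs ρ else 0 := by
  rw [sipmc, proj, Finset.filter_image, Finset.sum_image fun x _ y _ h => congrArg Prod.fst h,
    Finset.filter_eq']
  split_ifs
  · exact Finset.sum_singleton _ _
  · exact Finset.sum_empty

/-! ### Purging -/

theorem mem_nthRows {O : Finset (List (Row α))} {i : ℕ} {s : Row α} :
    s ∈ nthRows O i ↔ ∃ o ∈ O, o[i]? = some s := by
  simp [nthRows]

theorem nthRows_mono {O O' : Finset (List (Row α))} (h : O ⊆ O') (i : ℕ) :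
    nthRows O i ⊆ nthRows O' i :=
  Finset.biUnion_subset_biUnion_of_subset_left _ h

theorem mem_origs {t : TTree α (Table α)} {ρ : Table α} {o : List (Row α)} :
    o ∈ origs prog t ρ ↔ ∃ u ∈ ρ, o ∈ rowSeqs (t.children.map TTree.tab) ∧
      u ∈ phc prog t (o.map fun v => {v}) := by
  simp [origs, orig]

theorem origs_mono {t : TTree α (Table α)} {φ ν : Table α} (h : φ ⊆ ν) :
    origs prog t φ ⊆ origs prog t ν :=
  Finset.biUnion_subset_biUnion_of_subset_left _ h

theorem nthRows_origs_subset {t : TTree α (Table α)} {ν : Table α} {i : ℕ} {τ : Table α}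
    (hτ : (t.children.map TTree.tab)[i]? = some τ) : nthRows (origs prog t ν) i ⊆ τ := by
  intro s hs
  obtain ⟨o, ho, hos⟩ := mem_nthRows.1 hs
  obtain ⟨u, -, ho, -⟩ := mem_origs.1 ho
  exact mem_of_mem_rowSeqs ho hos hτ

theorem bag_purgeFrom (t : TTree α (Table α)) (ν : Table α) :
    (purgeFrom prog t ν).bag = t.bag := by
  cases t <;> rfl

theorem tab_purgeFrom (t : TTree α (Table α)) (ν : Table α) :
    (purgeFrom prog t ν).tab = ν := by
  cases t <;> rfl

theorem children_purgeFrom (t : TTree α (Table α)) (ν : Table α) :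
    (purgeFrom prog t ν).children =
      t.children.mapIdx fun i c => purgeFrom prog c (nthRows (origs prog t ν) i) := by
  cases t <;> rfl

theorem phc_purgeFrom (t : TTree α (Table α)) (ν : Table α) :
    phc prog (purgeFrom prog t ν) = phc prog t :=
  phc_congr (bag_purgeFrom t ν) <| by cases t <;> simp [purgeFrom, bag_purgeFrom]

theorem getElem?_tab_children_purgeFrom (t : TTree α (Table α)) (ν : Table α) (i : ℕ) :
    ((purgeFrom prog t ν).children.map TTree.tab)[i]? =
      t.children[i]?.map fun _ => nthRows (origs prog t ν) i := by
  simp [children_purgeFrom, tab_purgeFrom, Function.comp_def]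

theorem origs_purgeFrom {t : TTree α (Table α)} {φ ν : Table α} (h : φ ⊆ ν) :
    origs prog (purgeFrom prog t ν) φ = origs prog t φ := by
  ext o
  simp only [mem_origs, phc_purgeFrom]
  refine exists_congr fun u => and_congr_right fun hu => and_congr_left fun hphc => ?_
  have hlen : o.length = t.children.length := by simpa using length_eq_of_mem_phc hphc
  constructor <;> intro ho <;>
    refine mem_rowSeqs_of_getElem? (by simp [hlen, children_purgeFrom]) fun i s τ hs hτ => ?_
  · have htab : ((purgeFrom prog t ν).children.map TTree.tab)[i]? =
        some (nthRows (origs prog t ν) i) := by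
      rw [getElem?_tab_children_purgeFrom]
      rw [List.getElem?_map] at hτ
      exact Option.map_eq_some_iff.2 ((Option.map_eq_some_iff.1 hτ).imp fun _ hc => ⟨hc.1, rfl⟩)
    exact nthRows_origs_subset hτ (mem_of_mem_rowSeqs ho hs htab)
  · rw [getElem?_tab_children_purgeFrom] at hτ
    obtain ⟨-, -, rfl⟩ := Option.map_eq_some_iff.1 hτ
    exact mem_nthRows.2 ⟨o, mem_origs.2 ⟨u, h hu, ho, hphc⟩, hs⟩

/-! ### Projections -/

open Classical in
/-- The traces on `P` of the interpretations that realize the row `u` at the root of `T`. -/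
noncomputable def projs (prog : Program α) (P : Finset α) (T : TTree α ι) (u : Row α) :
    Finset (Finset α) :=
  P.powerset.filter fun Q => ∃ I, Realizes prog T u I ∧ I ∩ P = Q

variable {T : TTree α ι} {u : Row α} {o : List (Row α)} {ρ : Table α} {K Q : Finset α}

theorem mem_projs : Q ∈ projs prog P T u ↔ ∃ I, Realizes prog T u I ∧ I ∩ P = Q := by
  simp only [projs, Finset.mem_filter, Finset.mem_powerset, and_iff_right_iff_imp]
  rintro ⟨I, -, rfl⟩
  exact Finset.inter_subset_right

theorem inter_bag_of_mem_projs (h : Q ∈ projs prog P T u) : Q ∩ T.bag = u.interp ∩ P := by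
  obtain ⟨I, hI, rfl⟩ := mem_projs.1 h
  rw [hI.interp_eq, Finset.inter_right_comm]

theorem subset_cover_of_mem_projs (h : Q ∈ projs prog P T u) : Q ⊆ T.cover := by
  obtain ⟨I, hI, rfl⟩ := mem_projs.1 h
  exact Finset.inter_subset_left.trans hI.1

theorem eq_of_inter_bag_eq_of_inter_cover_eq {Q' : Finset α} (hQ : Q ⊆ T.cover)
    (hQ' : Q' ⊆ T.cover) (hbag : Q ∩ T.bag = Q' ∩ T.bag)
    (hcover : ∀ c ∈ T.children, Q ∩ c.cover = Q' ∩ c.cover) : Q = Q' := by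
  have key : ∀ v ∈ T.cover, v ∈ Q ↔ v ∈ Q' := fun v hv => by
    rcases TTree.mem_cover_iff_child.1 hv with hv | ⟨c, hc, hv⟩
    · simpa [hv] using congrArg (v ∈ ·) hbag
    · simpa [hv] using congrArg (v ∈ ·) (hcover c hc)
  exact Finset.ext fun v => ⟨fun h => (key v (hQ h)).1 h, fun h => (key v (hQ' h)).2 h⟩

theorem common_projs_eq_empty (hρ : ρ.Nonempty)
    (h : ¬ ∀ u ∈ ρ, ∀ v ∈ ρ, u.interp ∩ P = v.interp ∩ P) : common ρ (projs prog P T) = ∅ := by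
  refine Finset.eq_empty_iff_forall_notMem.2 fun Q hQ => h fun u hu v hv => ?_
  rw [mem_common hρ] at hQ
  exact (inter_bag_of_mem_projs (hQ u hu)).symm.trans (inter_bag_of_mem_projs (hQ v hv))

theorem sipmc_proj_eq_card {t : TTree α (Table α)} {πs : List (ProjTable α)} (hρ : ρ ⊆ t.tab)
    (hne : ρ.Nonempty)
    (h : (∀ u ∈ ρ, ∀ v ∈ ρ, u.interp ∩ P = v.interp ∩ P) →
      ipmc prog t πs ρ = (common ρ (projs prog P T)).card) :
    sipmc (proj prog P t πs) ρ = (common ρ (projs prog P T)).card := by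
  rw [sipmc_proj]
  split_ifs with hb
  · exact h (mem_subBuckets.1 hb).2.2
  · rw [common_projs_eq_empty hne fun h' => hb (mem_subBuckets.2 ⟨hne, hρ, h'⟩),
      Finset.card_empty]

open Classical in
/-- The subsets of `P` below `T` with trace `K` on the bag whose trace below the `i`-th child is a
projection for the `i`-th row of the origin `o`. For rows `u` with `u.interp ∩ P = K` and origin
`o`, these are projections for `u`. -/
noncomputable def originProjs (prog : Program α) (P : Finset α) (T : TTree α ι) (K : Finset α)
    (o : List (Row α)) : Finset (Finset α) :=
  T.cover.powerset.filter fun Q => Q ⊆ P ∧ Q ∩ T.bag = K ∧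
    ∀ (i : Fin T.children.length) s, o[(i : ℕ)]? = some s →
      Q ∩ T.children[i].cover ∈ projs prog P T.children[i] s

theorem mem_originProjs :
    Q ∈ originProjs prog P T K o ↔ Q ⊆ T.cover ∧ Q ⊆ P ∧ Q ∩ T.bag = K ∧
      ∀ (i : Fin T.children.length) s, o[(i : ℕ)]? = some s →
        Q ∩ T.children[i].cover ∈ projs prog P T.children[i] s := by
  simp only [originProjs, Finset.mem_filter, Finset.mem_powerset]

theorem exists_mem_projs_of_mem_phc (hT : T.NiceTree)
    (hu : u ∈ phc prog T (o.map fun v => {v})) {Qs : Fin T.children.length → Finset α}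
    (hQs : ∀ (i : Fin T.children.length) s, o[(i : ℕ)]? = some s →
      Qs i ∈ projs prog P T.children[i] s) :
    ∃ Q ∈ projs prog P T u, ∀ i : Fin T.children.length, Q ∩ T.children[i].cover = Qs i := by
  have hlen : o.length = T.children.length := by simpa using length_eq_of_mem_phc hu
  have hchild (i : Fin T.children.length) :
      ∃ J, Realizes prog T.children[i] (o[(i : ℕ)]'(by omega)) J ∧ J ∩ P = Qs i :=
    mem_projs.1 (hQs i _ (List.getElem?_eq_getElem _))
  choose J hJ hJQ using hchild
  obtain ⟨I, hI, hIJ⟩ := hT.exists_realizes_of_mem_phc hu (J := J) fun i s hs => by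
    obtain ⟨_, rfl⟩ := List.getElem?_eq_some_iff.1 hs
    exact hJ i
  refine ⟨I ∩ P, mem_projs.2 ⟨I, hI, rfl⟩, fun i => ?_⟩
  rw [Finset.inter_right_comm, hIJ, hJQ]

theorem children_dpPHC (prog : Program α) (T : TTree α ι) :
    (dpPHC prog T).children = T.children.map (dpPHC prog) :=
  TTree.children_dp _ T

theorem bag_dpPHC (prog : Program α) (T : TTree α ι) : (dpPHC prog T).bag = T.bag :=
  TTree.bag_dp _ T

theorem mem_origs_dpPHC {φ : Table α} :
    o ∈ origs prog (dpPHC prog T) φ ↔ ∃ u ∈ φ,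
      o ∈ rowSeqs (T.children.map fun c => (dpPHC prog c).tab) ∧
        u ∈ phc prog T (o.map fun v => {v}) := by
  have hphc : phc prog (dpPHC prog T) = phc prog T :=
    phc_congr (bag_dpPHC prog T) <| by
      simp [children_dpPHC, bag_dpPHC, Function.comp_def]
  simp only [mem_origs, hphc, children_dpPHC, List.map_map, Function.comp_def]

theorem exists_mem_originProjs_of_mem_projs (hT : T.NiceTree) {φ : Table α} (hu : u ∈ φ)
    (hK : u.interp ∩ P = K) (hQ : Q ∈ projs prog P T u) :
    ∃ o ∈ origs prog (dpPHC prog T) φ, Q ∈ originProjs prog P T K o := by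
  have hbag : Q ∩ T.bag = K := (inter_bag_of_mem_projs hQ).trans hK
  have hcover : Q ⊆ T.cover := subset_cover_of_mem_projs hQ
  obtain ⟨I, ⟨-, σ, hσ, hmem, hpartial, rfl⟩, rfl⟩ := mem_projs.1 hQ
  have hchild (c) (hc : c ∈ T.children) : Realizes prog c (rowOf prog c I σ) (I ∩ c.cover) :=
    realizes_rowOf_child hσ hmem hpartial hT hc
  refine ⟨T.children.map fun c => rowOf prog c I σ,
    mem_origs_dpPHC.2 ⟨_, hu, mem_rowSeqs.2 ?_, ?_⟩,
    mem_originProjs.2 ⟨hcover, Finset.inter_subset_right, hbag, fun i s hs => ?_⟩⟩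
  · rw [List.forall₂_map_left_iff, List.forall₂_map_right_iff, List.forall₂_same]
    exact fun c hc => (mem_dpPHC_tab (hT.child hc)).2 ⟨_, hchild c hc⟩
  · rw [List.map_map]
    exact hpartial.rowOf_mem_phc hT hσ hmem
  · obtain rfl : rowOf prog T.children[i] I σ = s := by simpa using hs
    exact mem_projs.2 ⟨_, hchild _ (List.getElem_mem _), Finset.inter_right_comm _ _ _⟩

theorem mem_projs_of_mem_originProjs (hT : T.NiceTree)
    (hu : u ∈ phc prog T (o.map fun v => {v})) (hK : u.interp ∩ P = K)
    (hQ : Q ∈ originProjs prog P T K o) : Q ∈ projs prog P T u := by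
  obtain ⟨hcover, -, hbag, hchild⟩ := mem_originProjs.1 hQ
  obtain ⟨Q', hQ', hQQ'⟩ := exists_mem_projs_of_mem_phc hT hu hchild
  rwa [eq_of_inter_bag_eq_of_inter_cover_eq hcover (subset_cover_of_mem_projs hQ')
    (hbag.trans (hK.symm.trans (inter_bag_of_mem_projs hQ').symm)) fun c hc => ?_]
  obtain ⟨i, hi, rfl⟩ := List.mem_iff_getElem.1 hc
  exact (hQQ' ⟨i, hi⟩).symm

theorem biUnion_projs_eq_biUnion_originProjs (hT : T.NiceTree) {φ : Table α}
    (hK : ∀ u ∈ φ, u.interp ∩ P = K) :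
    φ.biUnion (projs prog P T) =
      (origs prog (dpPHC prog T) φ).biUnion (originProjs prog P T K) := by
  ext Q
  simp only [Finset.mem_biUnion]
  constructor
  · rintro ⟨u, hu, hQ⟩
    exact exists_mem_originProjs_of_mem_projs hT hu (hK u hu) hQ
  · rintro ⟨o, ho, hQ⟩
    obtain ⟨u, hu, -, hphc⟩ := mem_origs_dpPHC.1 ho
    exact ⟨u, hu, mem_projs_of_mem_originProjs hT hphc (hK u hu) hQ⟩

theorem mem_common_originProjs {O : Finset (List (Row α))} (hO : O.Nonempty) :
    Q ∈ common O (originProjs prog P T K) ↔ Q ⊆ T.cover ∧ Q ⊆ P ∧ Q ∩ T.bag = K ∧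
      ∀ (i : Fin T.children.length), ∀ s ∈ nthRows O i,
        Q ∩ T.children[i].cover ∈ projs prog P T.children[i] s := by
  obtain ⟨o, ho⟩ := hO
  simp only [mem_common ⟨o, ho⟩, mem_originProjs, mem_nthRows]
  constructor
  · intro h
    obtain ⟨hcover, hP, hbag, -⟩ := h o ho
    refine ⟨hcover, hP, hbag, ?_⟩
    rintro i s ⟨o', ho', hs⟩
    exact (h o' ho').2.2.2 i s hs
  · rintro ⟨hcover, hP, hbag, h⟩ o' ho'
    exact ⟨hcover, hP, hbag, fun i s hs => h i s ⟨o', ho', hs⟩⟩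

theorem nthRows_nonempty {O : Finset (List (Row α))} {φ : Table α} (hO : O.Nonempty)
    (hOφ : O ⊆ origs prog (dpPHC prog T) φ) (i : Fin T.children.length) :
    (nthRows O i).Nonempty := by
  obtain ⟨o, ho⟩ := hO
  obtain ⟨u, -, -, hu⟩ := mem_origs_dpPHC.1 (hOφ ho)
  have hlen : o.length = T.children.length := by simpa using length_eq_of_mem_phc hu
  exact ⟨_, mem_nthRows.2 ⟨o, ho, List.getElem?_eq_getElem (by omega)⟩⟩

theorem card_common_originProjs (hT : T.NiceTree) {O : Finset (List (Row α))} {φ : Table α}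
    (hK : ∀ u ∈ φ, u.interp ∩ P = K) (hO : O.Nonempty)
    (hOφ : O ⊆ origs prog (dpPHC prog T) φ) :
    (common O (originProjs prog P T K)).card =
      ∏ i : Fin T.children.length, (common (nthRows O i) (projs prog P T.children[i])).card := by
  have hrows (i) : (nthRows O (i : Fin T.children.length)).Nonempty := nthRows_nonempty hO hOφ i
  rw [← Fintype.card_piFinset]
  refine Finset.card_nbij (fun Q i => Q ∩ T.children[i].cover) ?_ ?_ ?_
  · intro Q hQ
    simp only [Finset.mem_coe, Fintype.mem_piFinset, mem_common (hrows _)]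
    exact ((mem_common_originProjs hO).1 hQ).2.2.2
  · intro Q hQ Q' hQ' heq
    obtain ⟨hcover, -, hbag, -⟩ := (mem_common_originProjs hO).1 hQ
    obtain ⟨hcover', -, hbag', -⟩ := (mem_common_originProjs hO).1 hQ'
    refine eq_of_inter_bag_eq_of_inter_cover_eq hcover hcover' (hbag.trans hbag'.symm)
      fun c hc => ?_
    obtain ⟨i, hi, rfl⟩ := List.mem_iff_getElem.1 hc
    exact congrFun heq ⟨i, hi⟩
  · intro Qs hQs
    simp only [Finset.mem_coe, Fintype.mem_piFinset, mem_common (hrows _)] at hQs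
    obtain ⟨o, ho⟩ := id hO
    obtain ⟨u, hu, -, hphc⟩ := mem_origs_dpPHC.1 (hOφ ho)
    obtain ⟨Q, hQ, hQQs⟩ := exists_mem_projs_of_mem_phc hT hphc fun i s hs =>
      hQs i s (mem_nthRows.2 ⟨o, ho, hs⟩)
    refine ⟨Q, (mem_common_originProjs hO).2 ⟨subset_cover_of_mem_projs hQ, ?_,
      (inter_bag_of_mem_projs hQ).trans (hK u hu), fun i s hs => ?_⟩, funext hQQs⟩
    · obtain ⟨I, -, rfl⟩ := mem_projs.1 hQ
      exact Finset.inter_subset_right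
    · rw [hQQs]
      exact hQs i s hs

/-- After purging from any set `ν` of rows of the root, the stored intersection count of a set `ρ`
of remaining rows is the number of projections common to all rows of `ρ`. -/
def CountsCommon (prog : Program α) (P : Finset α) (T : TTree α ι) : Prop :=
  ∀ ν ⊆ (dpPHC prog T).tab, ∀ ρ ⊆ ν, ρ.Nonempty →
    sipmc (dpPROJ prog P (purgeFrom prog (dpPHC prog T) ν)).tab ρ =
      (common ρ (projs prog P T)).card

theorem countsCommon_leaf (x : ι) : CountsCommon prog P (.leaf ∅ x) := by
  intro ν hν ρ hρ hne
  rw [dpPROJ, TTree.tab_dp]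
  refine sipmc_proj_eq_card ((tab_purgeFrom (prog := prog) _ ν).symm ▸ hρ) hne fun _ => ?_
  have hempty : ∀ u ∈ ρ, ∅ ∈ projs prog P (.leaf ∅ x) u := fun u hu => by
    obtain ⟨I, hI⟩ := (mem_dpPHC_tab (.leaf x)).1 (hν (hρ hu))
    exact mem_projs.2 ⟨I, hI, by rw [Finset.subset_empty.1 hI.1, Finset.empty_inter]⟩
  have hcommon : common ρ (projs prog P (.leaf ∅ x)) = {∅} := by
    refine Finset.eq_singleton_iff_unique_mem.2 ⟨(mem_common hne).2 hempty, fun Q hQ => ?_⟩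
    obtain ⟨u, hu⟩ := hne
    exact Finset.subset_empty.1 (subset_cover_of_mem_projs ((mem_common ⟨u, hu⟩).1 hQ u hu))
  rw [hcommon, ipmc, Finset.card_singleton]
  rfl

theorem sipmcSeq_eq_prod {πs : List (ProjTable α)} {n : ℕ} (hn : πs.length = n)
    (O : Finset (List (Row α))) :
    sipmcSeq πs O = ∏ i : Fin n, sipmc (πs.getD i ∅) (nthRows O i) := by
  subst hn
  exact Finset.prod_range _

theorem CountsCommon.of_children (hT : T.NiceTree) (hleaf : T.children ≠ [])
    (hchild : ∀ c ∈ T.children, CountsCommon prog P c) : CountsCommon prog P T := by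
  intro ν _ ρ hρ hne
  have hchildren : (purgeFrom prog (dpPHC prog T) ν).children = T.children.mapIdx fun i c =>
      purgeFrom prog (dpPHC prog c) (nthRows (origs prog (dpPHC prog T) ν) i) := by
    refine List.ext_getElem? fun i => ?_
    simp [children_purgeFrom, children_dpPHC, Function.comp_def]
  rw [dpPROJ, TTree.tab_dp, hchildren]
  refine sipmc_proj_eq_card ((tab_purgeFrom (prog := prog) _ ν).symm ▸ hρ) hne fun hbucket =>
    ipmc_eq_card (by simpa [hchildren] using hleaf) hne fun φ hφ ⟨u, hu⟩ => ?_
  have hK : ∀ v ∈ φ, v.interp ∩ P = u.interp ∩ P := fun v hv => hbucket v (hφ hv) u (hφ hu)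
  rw [biUnion_projs_eq_biUnion_originProjs hT hK, ← origs_purgeFrom (hφ.trans hρ)]
  refine pmc_eq_card fun O hOφ hO => ?_
  rw [origs_purgeFrom (hφ.trans hρ)] at hOφ
  rw [card_common_originProjs hT hK hO hOφ, sipmcSeq_eq_prod (n := T.children.length) (by simp)]
  refine Finset.prod_congr rfl fun i _ => ?_
  have hνi : nthRows (origs prog (dpPHC prog T) ν) i ⊆ (dpPHC prog T.children[i]).tab :=
    nthRows_origs_subset (by simp [children_dpPHC])
  have hOi : nthRows O i ⊆ nthRows (origs prog (dpPHC prog T) ν) i :=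
    nthRows_mono (hOφ.trans (origs_mono (hφ.trans hρ))) i
  refine Eq.trans ?_ (hchild _ (List.getElem_mem _) _ hνi _ hOi (nthRows_nonempty hO hOφ i))
  simp [dpPROJ]

theorem TTree.NiceTree.countsCommon (hT : T.NiceTree) : CountsCommon prog P T := by
  induction T using TTree.children_induction with
  | step T ih =>
    by_cases hleaf : T.children = []
    · cases hT with
      | leaf x => exact countsCommon_leaf x
      | _ => simp at hleaf
    · exact .of_children hT hleaf fun c hc => ih c hc (hT.child hc)

theorem sipmc_dpPROJ_singleton_of_notMem {t : TTree α (Table α)} (h : u ∉ t.tab) :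
    sipmc (dpPROJ prog P t).tab {u} = 0 := by
  rw [dpPROJ, TTree.tab_dp, sipmc_proj, if_neg]
  exact fun hu => h (Finset.singleton_subset_iff.1 (mem_subBuckets.1 hu).2.1)

theorem sipmc_dpPROJ_purge_singleton (hT : T.NiceTree) (u : Row α) :
    sipmc (dpPROJ prog P (purge prog (dpPHC prog T))).tab {u} = (projs prog P T u).card := by
  by_cases hu : u ∈ (dpPHC prog T).tab
  · rw [purge, hT.countsCommon _ subset_rfl _ (Finset.singleton_subset_iff.2 hu)
      (Finset.singleton_nonempty u)]
    congr 1
    ext Q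
    simp [mem_common]
  · rw [sipmc_dpPROJ_singleton_of_notMem (by rwa [purge, tab_purgeFrom]), eq_comm,
      Finset.card_eq_zero, Finset.eq_empty_iff_forall_notMem]
    intro Q hQ
    obtain ⟨I, hI, -⟩ := mem_projs.1 hQ
    exact hu ((mem_dpPHC_tab hT).2 ⟨I, hI⟩)

theorem mdpPHC_eq_projectedCount (hcf : HeadCycleFree prog) (hne : prog ≠ {Rule.empty α})
    (hT : IsNiceTD prog T) : mdpPHC prog P T = projectedCount prog P := by
  have hprojs : (fun I => I ∩ P) '' {I | IsAnswerSet prog I} = projs prog P T (Row.empty α) := by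
    ext Q
    simp [mem_projs, hT.realizes_iff hcf hne]
  rw [projectedCount, hprojs, Set.ncard_coe_finset, mdpPHC,
    sipmc_dpPROJ_purge_singleton hT.niceTree]

end Projection

end PASP

theorem mainTheorem5 {α : Type*} [DecidableEq α] (prog : PASP.Program α) (P : Finset α)
    (hP : P ⊆ PASP.atoms prog) (hcf : PASP.HeadCycleFree prog)
    (hne : prog ≠ {PASP.Rule.empty α}) :
    (∃ T : PASP.TTree α Unit, PASP.IsNiceTD prog T) ∧
    ∀ T : PASP.TTree α Unit, PASP.IsNiceTD prog T →
      PASP.mdpPHC prog P T = PASP.projectedCount prog P :=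
  ⟨PASP.exists_isNiceTD prog, fun _ hT => PASP.mdpPHC_eq_projectedCount hcf hne hT⟩
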